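/- For integers $1\le k\le n-1$ let $D_{n,k\text{-out}}$ be the random digraph on the vertex set $[n]=\{1,\dots,n\}$ in which the vertices independently choose their out-neighbourhoods, each vertex $v$ choosing a set of $k$ out-neighbours uniformly at random from the $\binom{n-1}{k}$ $k$-element subsets of $[n]\setminus\{v\}$. Let $G_{n,k\text{-out}}$ be the random multigraph obtained from $D_{n,k\text{-out}}$ by ignoring the orientation of the arcs (each arc gives one edge, so two opposite arcs give two parallel edges). An $r$-colouring of the edges is any map from the set of edges to a set of $r$ colours (not necessarily proper); a monochromatic component is a connected component of the spanning subgraph formed by the edges of one colour, its order is its number of vertices, and a monochromatic cycle is a cycle all of whose edges have the same colour. **Theorem.** Let $r\ge 2$ be a fixed integer. (i) There is a function $f:\mathbb N\to\mathbb R$, depending only on $r$, with $f(n)=o(n)$ such that, with probability tending to $1$ as $n\to\infty$, there exists an $r$-colouring of the edges of $G_{n,r\text{-out}}$ in which every monochromatic component has order at most $f(n)$. (ii) There is a constant $\gamma>0$, depending only on $r$, such that, with probability tending to $1$ as $n\to\infty$, every $r$-colouring of the edges of $G_{n,(r+1)\text{-out}}$ contains a monochromatic cycle of length at least $\gamma n$.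 -/

import Mathlib

open Filter Topology Asymptotics MeasureTheory ProbabilityTheory
open scoped Graph

namespace KOut

/-- The possible out-neighbourhoods of the vertex `v` in a `k`-out digraph on `n` labelled
vertices: the `k`-element sets of vertices other than `v`. There are `(n - 1).choose k` of them. -/
def OutNbhd (n k : ℕ) (v : Fin n) : Type :=
  {S : Finset (Fin n) // v ∉ S ∧ S.card = k}

instance instFintypeOutNbhd (n k : ℕ) (v : Fin n) : Fintype (OutNbhd n k v) :=
  inferInstanceAs (Fintype {S : Finset (Fin n) // v ∉ S ∧ S.card = k})

instance instMeasurableSpaceOutNbhd (n k : ℕ) (v : Fin n) : MeasurableSpace (OutNbhd n k v) := ⊤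

instance instDiscreteOutNbhd (n k : ℕ) (v : Fin n) : DiscreteMeasurableSpace (OutNbhd n k v) :=
  ⟨fun _ => trivial⟩

/-- A `k`-out digraph on the vertex set `Fin n`: every vertex has a set of `k` out-neighbours. -/
abbrev OutDigraph (n k : ℕ) : Type := (v : Fin n) → OutNbhd n k v

/-- The law of the random `k`-out digraph: the vertices choose their out-neighbourhoods
independently, each uniformly at random. It is a probability measure whenever `k ≤ n - 1`. -/
noncomputable def outLaw (n k : ℕ) : Measure (OutDigraph n k) :=
  Measure.pi fun v => uniformOn (Set.univ : Set (OutNbhd n k v))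

/-- The multigraph obtained from a `k`-out digraph by ignoring the orientation of the arcs.
Its edges are the arcs `(u, v)`, so that two opposite arcs give two parallel edges. -/
def outGraph {n k : ℕ} (D : OutDigraph n k) : Graph (Fin n) (Fin n × Fin n) where
  vertexSet := Set.univ
  edgeSet := {e | e.2 ∈ (D e.1).1}
  IsLink e x y := e.2 ∈ (D e.1).1 ∧ (e = (x, y) ∨ e = (y, x))
  isLink_symm _ _ := ⟨fun _ _ h => ⟨h.1, h.2.symm⟩⟩
  eq_or_eq_of_isLink_of_isLink := by
    rintro ⟨a, b⟩ x y v w ⟨-, h⟩ ⟨-, h'⟩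
    simp only [Prod.mk.injEq] at h h'
    grind
  edge_mem_iff_exists_isLink := by
    rintro ⟨a, b⟩
    exact ⟨fun h => ⟨a, b, h, Or.inl rfl⟩, fun ⟨_, _, h, _⟩ => h⟩
  left_mem_of_isLink _ _ _ _ := Set.mem_univ _

/-- A (not necessarily proper) `r`-colouring of the edges of a multigraph. -/
abbrev EdgeColouring {V E : Type*} (G : Graph V E) (r : ℕ) : Type _ := E(G) → Fin r

/-- The simple graph underlying the spanning subgraph formed by the edges of colour `i`:
distinct `x` and `y` are adjacent if some edge of colour `i` joins them. Its connected components
are the monochromatic components of colour `i`, and its cycles are the monochromatic cycles of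
colour `i` of length at least three. -/
def colourClass {V E : Type*} {G : Graph V E} {r : ℕ} (c : EdgeColouring G r) (i : Fin r) :
    SimpleGraph V where
  Adj x y := x ≠ y ∧ ∃ e : E(G), c e = i ∧ G.IsLink e x y
  symm := ⟨fun _ _ h => ⟨h.1.symm, h.2.imp fun _ he => ⟨he.1, he.2.symm⟩⟩⟩
  loopless := ⟨fun _ h => h.1 rfl⟩

/-- Every monochromatic component of the colouring `c` has at most `m` vertices. -/
def MonoComponentsLE {V E : Type*} {G : Graph V E} {r : ℕ} (c : EdgeColouring G r) (m : ℝ) :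
    Prop :=
  ∀ (i : Fin r) (K : (colourClass c i).ConnectedComponent), (K.supp.ncard : ℝ) ≤ m

/-- The colouring `c` has a monochromatic cycle of length at least `ℓ`. -/
def HasMonoCycleGE {V E : Type*} {G : Graph V E} {r : ℕ} (c : EdgeColouring G r) (ℓ : ℝ) :
    Prop :=
  ∃ (i : Fin r) (x : V) (p : (colourClass c i).Walk x x), p.IsCycle ∧ ℓ ≤ (p.length : ℝ)

end KOut

namespace KOut

/-! Both parts are proved by counting digraphs.

Long cycles. The (r+1)-out graph has (r+1)n arcs, so some colour carries at least (1 + 1/r)n of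
them. A graph with no cycle longer than t falls into pieces of at most k₀ vertices once a set X of
at most 2tn/k₀ vertices is deleted (`exists_fragmentation`, from the depth-first search behind
`exists_long_cycle_or_separated`). For k₀ a small multiple of n, with high probability every set of
between k₀/2 and k₀ vertices spans at most 1 + 1/(4r) arcs per vertex (`card_dense_set_le`); for t a
much smaller multiple of n, few arcs touch X (`card_large_in_degree_le`). If all monochromatic
cycles were short, each colour would thus have fewer than (1 + 1/r)n arcs, a contradiction
(`hasMonoCycleGE_of_sparse`).

Small components. Ordering the out-neighbourhoods turns the digraph into r nearly uniform functions,
one per index. Delete the arcs of index i₀ that leave a fixed set X of about δn vertices: what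
remains of this functional graph is subcritical, and its components can be grouped into parts of
between m and 3m vertices, with m about ηn (`exists_balanced_coarsening`). Colour i₀ is used inside
the parts. Given the arcs of index i₀, an arc of another index crosses the partition with
probability bounded away from 1, so the crossing arcs of index i, coloured i, again form a
subcritical functional graph. The deleted arcs receive colour i₁ and merge only components meeting X
or its image, whose total size is small when δ is small compared with η
(`exists_colouring_of_partition`).

Subcriticality is a first moment estimate: two vertices of a functional graph are connected only if
their forward orbits meet, and for a given vertex the expected number of partners meeting it after a
and b steps is at most ρ^(a+b) with ρ < 1 (`sum_numOf_meet_le`). This yields components of order at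
most εn for each fixed ε, and `exists_isLittleO_of_tendsto` lets ε tend to 0. -/

/-! ### The random digraph as a counting model -/

open Classical in
/-- The out-neighbourhood systems of the `k`-out digraphs on `Fin n`, as a finset of functions. -/
noncomputable def outSets (n k : ℕ) : Finset (Fin n → Finset (Fin n)) :=
  Fintype.piFinset fun v => (Finset.univ.erase v).powersetCard k

lemma mem_outSets {n k : ℕ} {S : Fin n → Finset (Fin n)} :
    S ∈ outSets n k ↔ ∀ v, v ∉ S v ∧ (S v).card = k := by
  simp only [outSets, Fintype.mem_piFinset, Finset.mem_powersetCard]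
  refine forall_congr' fun v => and_congr_left fun _ => ?_
  constructor
  · intro h hv
    simpa using h hv
  · intro h x hx
    simp only [Finset.mem_erase, Finset.mem_univ, and_true]
    rintro rfl
    exact h hx

lemma out_mem_outSets {n k : ℕ} (D : OutDigraph n k) : (fun v => (D v).1) ∈ outSets n k :=
  mem_outSets.2 fun v => (D v).2

lemma out_injective (n k : ℕ) :
    Function.Injective fun (D : OutDigraph n k) (v : Fin n) => (D v).1 := by
  intro D D' h
  funext v
  exact Subtype.ext (congrFun h v)

lemma card_outDigraph (n k : ℕ) : Fintype.card (OutDigraph n k) = (outSets n k).card := by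
  classical
  rw [← Finset.card_univ, ← Finset.card_image_of_injective _ (out_injective n k)]
  congr 1
  ext S
  simp only [Finset.mem_image, Finset.mem_univ, true_and]
  constructor
  · rintro ⟨D, rfl⟩
    exact out_mem_outSets D
  · intro h
    exact ⟨fun v => ⟨S v, mem_outSets.1 h v⟩, rfl⟩

lemma outNbhd_nonempty {n k : ℕ} (h : k + 1 ≤ n) (v : Fin n) : Nonempty (OutNbhd n k v) := by
  classical
  obtain ⟨S, hS, hk⟩ := Finset.exists_subset_card_eq
    (show k ≤ (Finset.univ.erase v).card by
      rw [Finset.card_erase_of_mem (Finset.mem_univ v), Finset.card_univ, Fintype.card_fin]; omega)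
  exact ⟨⟨S, fun hv => by simpa using hS hv, hk⟩⟩

lemma outLaw_eq_uniformOn (n k : ℕ) :
    outLaw n k = uniformOn (Set.univ : Set (OutDigraph n k)) := by
  refine Measure.ext_of_singleton fun D => ?_
  rw [outLaw, Measure.pi_singleton, uniformOn_univ, Measure.count_singleton, Fintype.card_pi,
    Nat.cast_prod, one_div, ENNReal.prod_inv_distrib]
  · refine Finset.prod_congr rfl fun v _ => ?_
    rw [uniformOn_univ, Measure.count_singleton, one_div]
  · intro _ _ _ _ _
    exact Or.inr (ENNReal.natCast_ne_top _)

/-- A sequence of events has probability tending to one under the law of the random `k`-out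
digraph as soon as the proportion of the digraphs outside them tends to zero. -/
lemma tendsto_outLaw_one {k : ℕ} (E : ∀ n, Set (OutDigraph n k))
    (h : ∀ θ : ℝ, 0 < θ → ∀ᶠ n in atTop, ∃ bad : Finset (Fin n → Finset (Fin n)),
      (∀ D : OutDigraph n k, D ∉ E n → (fun v => (D v).1) ∈ bad) ∧
      (bad.card : ℝ) ≤ θ * (outSets n k).card) :
    Tendsto (fun n => outLaw n k (E n)) atTop (𝓝 1) := by
  classical
  have key : ∀ᶠ n in atTop, outLaw n k (E n) = 1 - outLaw n k (E n)ᶜ := by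
    filter_upwards [eventually_ge_atTop (k + 1)] with n hn
    have := fun v => outNbhd_nonempty hn v
    have hp : IsProbabilityMeasure (outLaw n k) := by
      rw [outLaw_eq_uniformOn]
      exact isProbabilityMeasure_uniformOn Set.finite_univ Set.univ_nonempty
    rw [← prob_compl_eq_one_sub (Set.toFinite _).measurableSet, compl_compl]
  have hc : Tendsto (fun n => outLaw n k (E n)ᶜ) atTop (𝓝 0) := by
    rw [ENNReal.tendsto_nhds_zero]
    intro ε hε
    obtain ⟨δ, hδ0, hδ⟩ := ENNReal.lt_iff_exists_nnreal_btwn.1 hε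
    have hδ1 : 0 < (δ : ℝ) := by simpa using hδ0
    filter_upwards [h δ hδ1, eventually_ge_atTop (k + 1)] with n hn hk
    have := fun v => outNbhd_nonempty hk v
    obtain ⟨bad, hb, hcard⟩ := hn
    refine le_trans ?_ hδ.le
    have h1 : ((E n)ᶜ.toFinset.card : ℝ) ≤ δ * Fintype.card (OutDigraph n k) := by
      rw [card_outDigraph]
      refine le_trans ?_ hcard
      rw [← Finset.card_image_of_injective _ (out_injective n k)]
      refine Nat.cast_le.2 (Finset.card_le_card ?_)
      intro S hS
      obtain ⟨D, hD, rfl⟩ := Finset.mem_image.1 hS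
      exact hb D (by simpa using hD)
    rw [outLaw_eq_uniformOn, uniformOn_univ,
      ← Set.coe_toFinset (E n)ᶜ, Measure.count_apply_finset]
    refine ENNReal.div_le_of_le_mul ?_
    have h2 : ((E n)ᶜ.toFinset.card : NNReal) ≤ δ * Fintype.card (OutDigraph n k) := by
      exact_mod_cast h1
    exact_mod_cast h2
  have := ENNReal.Tendsto.sub tendsto_const_nhds hc (Or.inl ENNReal.one_ne_top)
  rw [tsub_zero] at this
  exact this.congr' (key.mono fun n hn => hn.symm)

/-! ### Long cycles or small separators, by depth-first search -/

section LongCycles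

variable {V : Type*} [DecidableEq V]

open Classical in
/-- The vertices of `U` outside `W` with a neighbour in `W`. -/
noncomputable def outerNbrs (G : SimpleGraph V) (U W : Finset V) : Finset V :=
  (U \ W).filter fun y => ∃ w ∈ W, G.Adj y w

/-- No edge of `G` leads from `A` to `C \ A`. -/
def ClosedIn (G : SimpleGraph V) (C A : Finset V) : Prop :=
  ∀ a ∈ A, ∀ b ∈ C, b ∉ A → ¬ G.Adj a b

/-- Some vertex y of `N` lies at least t - 1 steps along `P` from its start x. The cycle goes from y
into `W`, through `W` to a neighbour of x, and back to y along `P`; the two linking edges bring the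
length to t + 1. -/
lemma exists_long_cycle_of_path {G : SimpleGraph V} {x z : V} (P : G.Walk x z) (hP : P.IsPath)
    {W N : Finset V} (hW : ∀ w ∈ W, w ∉ P.support) (hN : ∀ y ∈ N, y ∈ P.support)
    (hNW : ∀ y ∈ N, ∃ w ∈ W, G.Adj y w) {t : ℕ} (ht : 2 ≤ t) (htN : t ≤ N.card)
    (hconn : ∀ w ∈ W, ∃ a, ∃ q : G.Walk w a, (∀ b ∈ q.support, b ∈ W) ∧ G.Adj a x) :
    ∃ (y : V) (p : G.Walk y y), p.IsCycle ∧ t + 1 ≤ p.length := by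
  obtain ⟨y, hyN, hy, hyt⟩ : ∃ y, y ∈ N ∧ ∃ hy : y ∈ P.support,
      t - 1 ≤ (P.takeUntil y hy).length := by
    by_contra! hcon
    have hsub : N ⊆ (Finset.range (t - 1)).image P.getVert := by
      intro y hy
      refine Finset.mem_image.2 ⟨(P.takeUntil y (hN y hy)).length,
        Finset.mem_range.2 (hcon y hy (hN y hy)), ?_⟩
      exact SimpleGraph.Walk.getVert_length_takeUntil _
    have := (Finset.card_le_card hsub).trans Finset.card_image_le
    rw [Finset.card_range] at this
    omega
  obtain ⟨w, hw, hadj⟩ := hNW y hyN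
  obtain ⟨a, q, hq, hax⟩ := hconn w hw
  have hqb : ∀ b ∈ q.bypass.support, b ∈ W := fun b hb => hq b (q.support_bypass_subset_support hb)
  set T := P.takeUntil y hy with hT
  have hTs : ∀ b ∈ T.support, b ∈ P.support := fun b hb =>
    P.support_takeUntil_subset_support hy hb
  have hpath : (q.bypass.append (SimpleGraph.Walk.cons hax T)).IsPath := by
    rw [SimpleGraph.Walk.isPath_def, SimpleGraph.Walk.support_append,
      SimpleGraph.Walk.support_cons, List.tail_cons, List.nodup_append]
    refine ⟨q.bypass_isPath.support_nodup, (hP.takeUntil hy).support_nodup, ?_⟩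
    rintro b hb c hc rfl
    exact hW b (hqb b hb) (hTs b hc)
  have hyW : y ∉ W := fun h => hW y h hy
  refine ⟨y, SimpleGraph.Walk.cons hadj (q.bypass.append (SimpleGraph.Walk.cons hax T)), ?_, ?_⟩
  · rw [SimpleGraph.Walk.cons_isCycle_iff]
    refine ⟨hpath, ?_⟩
    rw [SimpleGraph.Walk.edges_append, SimpleGraph.Walk.edges_cons, List.mem_append, List.mem_cons]
    rintro (h | h | h)
    · exact hyW (hqb y (SimpleGraph.Walk.fst_mem_support_of_mem_edges _ h))
    -- The closing edge could only repeat the edge from a to x if y = x, which t - 1 ≥ 1 excludes.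
    · have hyx : y = x := by
        rcases Sym2.eq_iff.1 h with ⟨h1, -⟩ | ⟨h1, -⟩
        · exact absurd (h1 ▸ hqb a (SimpleGraph.Walk.end_mem_support _)) hyW
        · exact h1
      subst hyx
      rw [hT, SimpleGraph.Walk.takeUntil_first] at hyt
      simp only [SimpleGraph.Walk.length_nil] at hyt
      omega
    · exact hW w hw (hTs w (SimpleGraph.Walk.snd_mem_support_of_mem_edges _ h))
  · simp only [SimpleGraph.Walk.length_cons, SimpleGraph.Walk.length_append]
    omega

/-- Closed sets are unions of components of the graph induced on `C`, and `W` is a smallest one with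
at least k/2 vertices. If `W` has more than k vertices and splits into two closed sets, one of them
still has at least k/2 vertices, against minimality. -/
lemma exists_closedIn_min (G : SimpleGraph V) (C : Finset V) {k : ℕ} (hk : k ≤ 2 * C.card) :
    ∃ W ⊆ C, ClosedIn G C W ∧ k ≤ 2 * W.card ∧
      (W.card ≤ k ∨ ∀ A ⊆ W, A.Nonempty → ClosedIn G W A → A = W) := by
  classical
  obtain ⟨W, hW, hmin⟩ := Finset.exists_min_image
    (C.powerset.filter fun W => ClosedIn G C W ∧ k ≤ 2 * W.card) Finset.card
    ⟨C, by simp only [Finset.mem_filter, Finset.mem_powerset]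
           exact ⟨subset_rfl, fun a _ b hb hb' => absurd hb hb', hk⟩⟩
  simp only [Finset.mem_filter, Finset.mem_powerset] at hW hmin
  refine ⟨W, hW.1, hW.2.1, hW.2.2, ?_⟩
  by_cases hWk : W.card ≤ k
  · exact Or.inl hWk
  refine Or.inr fun A hA hne hcl => ?_
  have hAC : ClosedIn G C A := by
    intro a ha b hb hbA
    by_cases hbW : b ∈ W
    · exact hcl a ha b hbW hbA
    · exact hW.2.1 a (hA ha) b hb hbW
  have hBC : ClosedIn G C (W \ A) := by
    intro a ha b hb hbA hab
    rw [Finset.mem_sdiff] at ha hbA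
    by_cases hbW : b ∈ W
    · have hbA' : b ∈ A := by tauto
      exact hcl b hbA' a ha.1 ha.2 hab.symm
    · exact hW.2.1 a ha.1 b hb hbW hab
  have hcard := Finset.card_sdiff_add_card_eq_card hA
  by_cases h1 : k ≤ 2 * A.card
  · exact Finset.eq_of_subset_of_card_le hA (hmin A ⟨hA.trans hW.1, hAC, h1⟩)
  · by_cases h2 : k ≤ 2 * (W \ A).card
    · have := hmin (W \ A) ⟨Finset.sdiff_subset.trans hW.1, hBC, h2⟩
      have := hne.card_pos
      omega
    · omega

/-- `P` is the stack of a depth-first search with tip x and `C` the unexplored region: every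
neighbour of `C` in `U` outside `C` lies on `P`, and every component of `C` is joined to x. A closed
`W` with at most k vertices either has few outer neighbours or closes a long cycle with `P`. A
larger indecomposable `W` is entered at a neighbour v of x, which becomes the new tip, and `W`
without v still has at least k vertices. -/
lemma exists_long_cycle_or_separated_aux (G : SimpleGraph V) (U : Finset V) {k t : ℕ}
    (ht : 2 ≤ t) : ∀ (m : ℕ) (C : Finset V) (x z : V) (P : G.Walk x z), C.card ≤ m → P.IsPath →
      (∀ c ∈ C, c ∉ P.support) → C ⊆ U → k ≤ C.card →
      (∀ y ∈ outerNbrs G U C, y ∈ P.support) →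
      (∀ A ⊆ C, A.Nonempty → ClosedIn G C A → ∃ a ∈ A, G.Adj a x) →
      (∃ (y : V) (p : G.Walk y y), p.IsCycle ∧ t + 1 ≤ p.length) ∨
      ∃ W ⊆ U, k ≤ 2 * W.card ∧ W.card ≤ k ∧ (outerNbrs G U W).card < t := by
  classical
  intro m
  induction m with
  | zero =>
    intro C x z P hC _ _ hCU hk _ _
    have : C = ∅ := Finset.card_eq_zero.1 (by omega)
    subst this
    right
    refine ⟨∅, Finset.empty_subset _, by simpa using hk, by simp, ?_⟩
    simp [outerNbrs]; omega
  | succ m ih =>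
    intro C x z P hC hP hCP hCU hk hNC hadj
    obtain ⟨W, hWC, hcl, hkW, hW⟩ := exists_closedIn_min G C (k := k) (by omega)
    have hNW : ∀ y ∈ outerNbrs G U W, y ∈ P.support := by
      intro y hy
      simp only [outerNbrs, Finset.mem_filter, Finset.mem_sdiff] at hy hNC
      obtain ⟨⟨hyU, hyW⟩, w, hw, hyw⟩ := hy
      by_cases hyC : y ∈ C
      · exact absurd hyw.symm (hcl w hw y hyC hyW)
      · exact hNC y ⟨⟨hyU, hyC⟩, w, hWC hw, hyw⟩
    have htrans : ∀ A ⊆ W, ClosedIn G W A → ClosedIn G C A := by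
      intro A hA hAW a ha b hb hbA
      by_cases hbW : b ∈ W
      · exact hAW a ha b hbW hbA
      · exact hcl a (hA ha) b hb hbW
    by_cases hWk : W.card ≤ k
    · by_cases hlt : (outerNbrs G U W).card < t
      · exact Or.inr ⟨W, hWC.trans hCU, hkW, hWk, hlt⟩
      left
      refine exists_long_cycle_of_path P hP (W := W) (N := outerNbrs G U W)
        (fun w hw => hCP w (hWC hw)) hNW ?_ ht (not_lt.1 hlt) ?_
      · intro y hy
        exact (Finset.mem_filter.1 hy).2
      · intro w hw
        -- The component of w inside `W` is closed, so it contains a neighbour of the tip x.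
        let A := W.filter fun a => ∃ q : G.Walk w a, ∀ b ∈ q.support, b ∈ W
        have hAW : A ⊆ W := Finset.filter_subset _ _
        have hwA : w ∈ A := Finset.mem_filter.2 ⟨hw, SimpleGraph.Walk.nil, by simpa using hw⟩
        have hAcl : ClosedIn G W A := by
          intro a ha b hb hbA hab
          obtain ⟨-, q, hq⟩ := Finset.mem_filter.1 ha
          refine hbA (Finset.mem_filter.2 ⟨hb, q.concat hab, ?_⟩)
          intro c hc
          rw [SimpleGraph.Walk.support_concat, List.mem_append, List.mem_singleton] at hc
          rcases hc with hc | rfl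
          · exact hq c hc
          · exact hb
        obtain ⟨a, ha, hax⟩ := hadj A (hAW.trans hWC) ⟨w, hwA⟩ (htrans A hAW hAcl)
        obtain ⟨-, q, hq⟩ := Finset.mem_filter.1 ha
        exact ⟨a, q, hq, hax⟩
    · have hind := hW.resolve_left hWk
      have hne : W.Nonempty := Finset.card_pos.1 (by omega)
      obtain ⟨v, hv, hvx⟩ := hadj W hWC hne hcl
      have hcard := Finset.card_erase_add_one hv
      have hle := Finset.card_le_card hWC
      refine ih (W.erase v) v z (SimpleGraph.Walk.cons hvx P) (by omega) ?_ ?_ ?_ (by omega) ?_ ?_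
      · exact hP.cons (hCP v (hWC hv))
      · intro c hc
        rw [Finset.mem_erase] at hc
        rw [SimpleGraph.Walk.support_cons, List.mem_cons, not_or]
        exact ⟨hc.1, hCP c (hWC hc.2)⟩
      · exact (Finset.erase_subset _ _).trans (hWC.trans hCU)
      · intro y hy
        rw [SimpleGraph.Walk.support_cons, List.mem_cons]
        by_cases hyv : y = v
        · exact Or.inl hyv
        right
        refine hNW y ?_
        simp only [outerNbrs, Finset.mem_filter, Finset.mem_sdiff, Finset.mem_erase] at hy ⊢
        obtain ⟨⟨hyU, hyW⟩, w, hw, hyw⟩ := hy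
        exact ⟨⟨hyU, fun h => hyW ⟨hyv, h⟩⟩, w, hw.2, hyw⟩
      · intro A hA hAne hAcl
        -- If v had no neighbour in `A`, then `A` would be closed in `W` as well, hence all of `W`,
        -- although v is not in `A`.
        by_contra! hcon
        have : A = W := by
          refine hind A (hA.trans (Finset.erase_subset _ _)) hAne ?_
          intro a ha b hb hbA hab
          by_cases hbv : b = v
          · exact hcon a ha (hbv ▸ hab)
          · exact hAcl a ha b (Finset.mem_erase.2 ⟨hbv, hb⟩) hbA hab
        subst this
        simpa using hA hv

/-- Krivelevich: a graph in which every set of between `k / 2` and `k` vertices has at least `t`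
outer neighbours contains a cycle of length at least `t + 1`. -/
lemma exists_long_cycle_or_separated (G : SimpleGraph V) (U : Finset V) {k t : ℕ}
    (ht : 2 ≤ t) (hk : k < U.card) :
    (∃ (y : V) (p : G.Walk y y), p.IsCycle ∧ t + 1 ≤ p.length) ∨
      ∃ W ⊆ U, k ≤ 2 * W.card ∧ W.card ≤ k ∧ (outerNbrs G U W).card < t := by
  classical
  obtain ⟨W, hWU, hcl, hkW, hW⟩ := exists_closedIn_min G U (k := k) (by omega)
  have hN : ∀ y, y ∉ outerNbrs G U W := by
    intro y hy
    simp only [outerNbrs, Finset.mem_filter, Finset.mem_sdiff] at hy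
    obtain ⟨⟨hyU, hyW⟩, w, hw, hyw⟩ := hy
    exact hcl w hw y hyU hyW hyw.symm
  by_cases hWk : W.card ≤ k
  · refine Or.inr ⟨W, hWU, hkW, hWk, ?_⟩
    rw [Finset.eq_empty_of_forall_notMem hN, Finset.card_empty]
    omega
  have hind := hW.resolve_left hWk
  have hne : W.Nonempty := Finset.card_pos.1 (by omega)
  obtain ⟨v, hv⟩ := hne
  have hcard := Finset.card_erase_add_one hv
  refine exists_long_cycle_or_separated_aux G U ht _ (W.erase v) v v SimpleGraph.Walk.nil le_rfl
    SimpleGraph.Walk.IsPath.nil ?_ ((Finset.erase_subset _ _).trans hWU) (by omega) ?_ ?_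
  · intro c hc
    simpa using (Finset.mem_erase.1 hc).1
  · intro y hy
    by_cases hyv : y = v
    · simpa using hyv
    refine absurd ?_ (hN y)
    simp only [outerNbrs, Finset.mem_filter, Finset.mem_sdiff, Finset.mem_erase] at hy ⊢
    obtain ⟨⟨hyU, hyW⟩, w, hw, hyw⟩ := hy
    exact ⟨⟨hyU, fun h => hyW ⟨hyv, h⟩⟩, w, hw.2, hyw⟩
  · intro A hA hAne hAcl
    by_contra! hcon
    have : A = W := by
      refine hind A (hA.trans (Finset.erase_subset _ _)) hAne ?_
      intro a ha b hb hbA hab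
      by_cases hbv : b = v
      · exact hcon a ha (hbv ▸ hab)
      · exact hAcl a ha b (Finset.mem_erase.2 ⟨hbv, hb⟩) hbA hab
    subst this
    simpa using hA hv

/-- Repeatedly split off a separated `W` and put its outer neighbours into `X`. Each round adds
fewer than t vertices to `X` and uses up at least k/2 vertices of `U`, whence the bound on `X`.
Afterwards no arc of `A` joins `W` to the rest, so the arc counts add up; the term c * k pays for
the last piece, which may be too small for `h1`. -/
lemma exists_fragmentation (G : SimpleGraph V) {k t : ℕ} (ht : 2 ≤ t) (hk0 : 0 < k)
    (hcyc : ∀ (y : V) (p : G.Walk y y), p.IsCycle → p.length ≤ t) (A : Finset (V × V))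
    (hA : ∀ e ∈ A, e.1 ≠ e.2 → G.Adj e.1 e.2) {c : ℝ} (hc : 0 ≤ c)
    (h1 : ∀ W : Finset V, k ≤ 2 * W.card → W.card ≤ k →
      ((A.filter fun e => e.1 ∈ W ∧ e.2 ∈ W).card : ℝ) ≤ c * W.card)
    (h2 : ∀ W : Finset V, W.card ≤ k →
      ((A.filter fun e => e.1 ∈ W ∧ e.2 ∈ W).card : ℝ) ≤ c * k) :
    ∀ (m : ℕ) (U : Finset V), U.card ≤ m → ∃ X : Finset V, X.card * k ≤ 2 * t * U.card ∧
      ((A.filter fun e => e.1 ∈ U \ X ∧ e.2 ∈ U \ X).card : ℝ) ≤ c * U.card + c * k := by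
  intro m
  induction m with
  | zero =>
    intro U hU
    refine ⟨∅, by simp, ?_⟩
    have := h2 U (by omega)
    rw [Finset.sdiff_empty]
    have : 0 ≤ c * (U.card : ℝ) := by positivity
    linarith
  | succ m ih =>
    intro U hU
    by_cases hUk : U.card ≤ k
    · refine ⟨∅, by simp, ?_⟩
      have := h2 U hUk
      rw [Finset.sdiff_empty]
      have : 0 ≤ c * (U.card : ℝ) := by positivity
      linarith
    rcases exists_long_cycle_or_separated G U ht (not_le.1 hUk) with
      ⟨y, p, hp, hpt⟩ | ⟨W, hWU, hkW, hWk, hN⟩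
    · have := hcyc y p hp
      omega
    set N := outerNbrs G U W with hNdef
    have hcard : (U \ (W ∪ N)).card + W.card ≤ U.card := by
      rw [← Finset.card_sdiff_add_card_eq_card hWU]
      exact Nat.add_le_add_right
        (Finset.card_le_card (Finset.sdiff_subset_sdiff subset_rfl Finset.subset_union_left)) _
    obtain ⟨X, hX, hXe⟩ := ih (U \ (W ∪ N)) (by omega)
    refine ⟨N ∪ X, ?_, ?_⟩
    · calc (N ∪ X).card * k ≤ (N.card + X.card) * k :=
            Nat.mul_le_mul_right _ (Finset.card_union_le _ _)
        _ = N.card * k + X.card * k := add_mul _ _ _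
        _ ≤ t * (2 * W.card) + 2 * t * (U \ (W ∪ N)).card := by gcongr
        _ = 2 * t * ((U \ (W ∪ N)).card + W.card) := by ring
        _ ≤ 2 * t * U.card := by gcongr
    · have hsub : (A.filter fun e => e.1 ∈ U \ (N ∪ X) ∧ e.2 ∈ U \ (N ∪ X)) ⊆
          (A.filter fun e => e.1 ∈ W ∧ e.2 ∈ W) ∪
          (A.filter fun e => e.1 ∈ (U \ (W ∪ N)) \ X ∧ e.2 ∈ (U \ (W ∪ N)) \ X) := by
        rintro ⟨a, b⟩ he
        have hNmem : ∀ y, y ∈ N ↔ (y ∈ U ∧ y ∉ W) ∧ ∃ w ∈ W, G.Adj y w := by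
          intro y
          simp only [hNdef, outerNbrs, Finset.mem_filter, Finset.mem_sdiff]
        simp only [Finset.mem_filter, Finset.mem_sdiff, Finset.mem_union, not_or] at he ⊢
        obtain ⟨heA, ⟨haU, haN, haX⟩, hbU, hbN, hbX⟩ := he
        have hadj : a ≠ b → G.Adj a b := hA _ heA
        by_cases haW : a ∈ W <;> by_cases hbW : b ∈ W
        · exact Or.inl ⟨heA, haW, hbW⟩
        · exact absurd ((hNmem b).2 ⟨⟨hbU, hbW⟩, a, haW,
            (hadj fun h => hbW (h ▸ haW)).symm⟩) hbN
        · exact absurd ((hNmem a).2 ⟨⟨haU, haW⟩, b, hbW,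
            hadj fun h => haW (h ▸ hbW)⟩) haN
        · exact Or.inr ⟨heA, ⟨⟨haU, haW, haN⟩, haX⟩, ⟨hbU, hbW, hbN⟩, hbX⟩
      have hle : ((A.filter fun e => e.1 ∈ U \ (N ∪ X) ∧ e.2 ∈ U \ (N ∪ X)).card : ℝ) ≤
          ((A.filter fun e => e.1 ∈ W ∧ e.2 ∈ W).card : ℝ) +
          ((A.filter fun e => e.1 ∈ (U \ (W ∪ N)) \ X ∧
            e.2 ∈ (U \ (W ∪ N)) \ X).card : ℝ) := by
        exact_mod_cast (Finset.card_le_card hsub).trans (Finset.card_union_le _ _)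
      have hW := h1 W hkW hWk
      have hcard' : ((U \ (W ∪ N)).card : ℝ) + W.card ≤ U.card := by exact_mod_cast hcard
      have := mul_le_mul_of_nonneg_left hcard' hc
      linarith

end LongCycles

/-! ### First moment bounds for arcs -/

/-- The ratio of the binomials is the product of (k - i)/(m - i) over i < j, and each factor is at
most k/m. -/
lemma choose_sub_mul_pow_le {m k : ℕ} (hkm : k ≤ m) {j : ℕ} (hj : j ≤ k) :
    (m - j).choose (k - j) * m ^ j ≤ k ^ j * m.choose k := by
  induction j with
  | zero => simp
  | succ j ih =>
    have ih := ih (by omega)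
    obtain ⟨a, ha⟩ : ∃ a, m - j = a + 1 := ⟨m - j - 1, by omega⟩
    obtain ⟨c, hc⟩ : ∃ c, k - j = c + 1 := ⟨k - j - 1, by omega⟩
    have e1 : m - (j + 1) = a := by omega
    have e2 : k - (j + 1) = c := by omega
    rw [ha, hc] at ih
    rw [e1, e2]
    have h := Nat.add_one_mul_choose_eq a c
    have hkm' : (c + 1) * m ≤ k * (a + 1) := by
      obtain ⟨d, rfl⟩ := Nat.exists_eq_add_of_le hkm
      have hk : k = j + c + 1 := by omega
      have ha' : a = c + d := by omega
      subst ha'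
      subst hk
      nlinarith
    refine Nat.le_of_mul_le_mul_left ?_ (Nat.succ_pos a)
    calc (a + 1) * (a.choose c * m ^ (j + 1)) = ((a + 1) * a.choose c) * (m ^ j * m) := by ring
      _ = ((a + 1).choose (c + 1) * m ^ j) * ((c + 1) * m) := by rw [h]; ring
      _ ≤ (k ^ j * m.choose k) * (k * (a + 1)) := by gcongr
      _ = (a + 1) * (k ^ (j + 1) * m.choose k) := by ring

lemma card_powersetCard_superset_mul_le {α : Type*} [DecidableEq α] (M T : Finset α) {k : ℕ}
    (hk : k ≤ M.card) :
    (((M.powersetCard k).filter fun S => T ⊆ S).card) * M.card ^ T.card ≤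
      k ^ T.card * (M.powersetCard k).card := by
  by_cases h : T ⊆ M ∧ T.card ≤ k
  · have hle : ((M.powersetCard k).filter fun S => T ⊆ S).card ≤
        ((M \ T).powersetCard (k - T.card)).card := by
      refine Finset.card_le_card_of_injOn (fun S => S \ T) ?_ ?_
      · intro S hS
        simp only [Finset.coe_filter, Finset.mem_powersetCard, Set.mem_ofPred_eq] at hS
        simp only [Finset.mem_coe, Finset.mem_powersetCard]
        exact ⟨Finset.sdiff_subset_sdiff hS.1.1 subset_rfl,
          by rw [Finset.card_sdiff_of_subset hS.2, hS.1.2]⟩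
      · intro S hS S' hS' hSS
        simp only [Finset.coe_filter, Finset.mem_powersetCard, Set.mem_ofPred_eq] at hS hS'
        rw [← Finset.sdiff_union_of_subset hS.2, ← Finset.sdiff_union_of_subset hS'.2]
        exact congrArg (· ∪ T) hSS
    rw [Finset.card_powersetCard, Finset.card_sdiff_of_subset h.1] at hle
    rw [Finset.card_powersetCard]
    exact (Nat.mul_le_mul_right _ hle).trans (choose_sub_mul_pow_le hk h.2)
  · have : ((M.powersetCard k).filter fun S => T ⊆ S) = ∅ := by
      refine Finset.filter_eq_empty_iff.2 fun S hS hTS => h ?_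
      rw [Finset.mem_powersetCard] at hS
      exact ⟨hTS.trans hS.1, hS.2 ▸ Finset.card_le_card hTS⟩
    rw [this, Finset.card_empty, zero_mul]
    exact Nat.zero_le _

/-- The arcs of a digraph given by its out-neighbourhoods. -/
def arcs {n : ℕ} (S : Fin n → Finset (Fin n)) : Finset (Fin n × Fin n) :=
  Finset.univ.filter fun e => e.2 ∈ S e.1

lemma mem_arcs {n : ℕ} {S : Fin n → Finset (Fin n)} {e : Fin n × Fin n} :
    e ∈ arcs S ↔ e.2 ∈ S e.1 := by
  simp [arcs]

lemma card_eq_sum_card_sections {n : ℕ} (T : Finset (Fin n × Fin n)) :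
    T.card = ∑ v, (Finset.univ.filter fun w => (v, w) ∈ T).card := by
  rw [Finset.card_eq_sum_card_fiberwise (f := Prod.fst) (t := Finset.univ)
    (fun _ _ => Finset.mem_coe.2 (Finset.mem_univ _))]
  refine Finset.sum_congr rfl fun v _ => ?_
  refine Finset.card_bij' (fun e _ => e.2) (fun w _ => (v, w)) ?_ ?_ ?_ ?_
  · rintro ⟨a, b⟩ h
    simp only [Finset.mem_filter, Finset.mem_univ, true_and] at h ⊢
    obtain ⟨h, rfl⟩ := h
    exact h
  · intro w h
    simpa using h
  · rintro ⟨a, b⟩ h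
    simp only [Finset.mem_filter] at h
    simp [h.2]
  · intro w _
    rfl

lemma card_arcs {n k : ℕ} {S : Fin n → Finset (Fin n)} (hS : S ∈ outSets n k) :
    (arcs S).card = n * k := by
  rw [card_eq_sum_card_sections]
  have : ∀ v, (Finset.univ.filter fun w => (v, w) ∈ arcs S).card = k := by
    intro v
    rw [← (mem_outSets.1 hS v).2]
    congr 1
    ext w
    simp [mem_arcs]
  simp [this]

/-- Vertices choose independently, so the count factors over the sections of `T`: an arc set is at
most as likely as if its arcs were independent of probability k/(n - 1). -/
lemma card_arcs_superset_mul_le {n k : ℕ} (hk : k + 1 ≤ n) (T : Finset (Fin n × Fin n)) :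
    ((outSets n k).filter fun S => T ⊆ arcs S).card * (n - 1) ^ T.card ≤
      k ^ T.card * (outSets n k).card := by
  classical
  have hM : ∀ v : Fin n, (Finset.univ.erase v).card = n - 1 := fun v => by
    rw [Finset.card_erase_of_mem (Finset.mem_univ v), Finset.card_univ, Fintype.card_fin]
  have heq : ((outSets n k).filter fun S => T ⊆ arcs S) = Fintype.piFinset fun v =>
      ((Finset.univ.erase v).powersetCard k).filter fun S =>
        (Finset.univ.filter fun w => (v, w) ∈ T) ⊆ S := by
    ext S
    simp only [outSets, Finset.mem_filter, Fintype.mem_piFinset, forall_and]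
    refine and_congr_right fun _ => ?_
    constructor
    · intro h v w hw
      exact mem_arcs.1 (h (by simpa using hw))
    · rintro h ⟨v, w⟩ he
      exact mem_arcs.2 (h v (by simpa using he))
  rw [heq, Fintype.card_piFinset, card_eq_sum_card_sections T, ← Finset.prod_pow_eq_pow_sum,
    ← Finset.prod_pow_eq_pow_sum, outSets, Fintype.card_piFinset, ← Finset.prod_mul_distrib,
    ← Finset.prod_mul_distrib]
  refine Finset.prod_le_prod (fun _ _ => Nat.zero_le _) fun v _ => ?_
  have := card_powersetCard_superset_mul_le (Finset.univ.erase v)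
    (Finset.univ.filter fun w => (v, w) ∈ T) (k := k) (by rw [hM]; omega)
  rwa [hM] at this

lemma choose_le_pow (q : ℕ) {t : ℕ} (ht : 1 ≤ t) : (q.choose t : ℝ) ≤ (3 * q / t) ^ t := by
  have ht' : (0 : ℝ) < t := by exact_mod_cast ht
  have h1 : (q.choose t : ℝ) ≤ (q : ℝ) ^ t / t.factorial := Nat.choose_le_pow_div t q
  have h2 : (t : ℝ) ^ t / t.factorial ≤ 3 ^ t := by
    refine (Real.pow_div_factorial_le_exp _ ht'.le t).trans ?_
    rw [← Real.exp_one_pow]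
    exact pow_le_pow_left₀ (Real.exp_pos _).le Real.exp_one_lt_three.le _
  refine h1.trans ?_
  rw [div_pow, mul_pow, le_div_iff₀ (by positivity)]
  calc (q : ℝ) ^ t / t.factorial * t ^ t = (t : ℝ) ^ t / t.factorial * q ^ t := by ring
    _ ≤ 3 ^ t * q ^ t := by gcongr

/-- Union bound over the t-element subsets of `Q`, with 1/(n - 1) ≤ 2/n and the binomial bounded by
(3|Q|/t)^t. -/
lemma card_many_arcs_le {n k t : ℕ} (hk : k + 1 ≤ n) (hn : 2 ≤ n) (ht : 1 ≤ t)
    (Q : Finset (Fin n × Fin n)) :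
    (((outSets n k).filter fun S => t ≤ (arcs S ∩ Q).card).card : ℝ) ≤
      (6 * Q.card * k / (t * n)) ^ t * (outSets n k).card := by
  have hn' : (2 : ℝ) ≤ n := by exact_mod_cast hn
  have hn1 : ((n - 1 : ℕ) : ℝ) = n - 1 := by rw [Nat.cast_sub (by omega)]; simp
  have ht' : (0 : ℝ) < t := by exact_mod_cast ht
  have hT : ∀ T ∈ Q.powersetCard t, (((outSets n k).filter fun S => T ⊆ arcs S).card : ℝ) ≤
      (2 * k / n) ^ t * (outSets n k).card := by
    intro T hT
    have hTt := (Finset.mem_powersetCard.1 hT).2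
    have h := card_arcs_superset_mul_le hk T
    rw [hTt] at h
    have h' : (((outSets n k).filter fun S => T ⊆ arcs S).card : ℝ) * ((n : ℝ) - 1) ^ t ≤
        (k : ℝ) ^ t * (outSets n k).card := by
      rw [← hn1]
      exact_mod_cast h
    have hpos : (0 : ℝ) < ((n : ℝ) - 1) ^ t := pow_pos (by linarith) _
    rw [← le_div_iff₀ hpos] at h'
    refine h'.trans ?_
    rw [mul_div_right_comm, ← div_pow]
    refine mul_le_mul_of_nonneg_right (pow_le_pow_left₀ ?_ ?_ _) (Nat.cast_nonneg _)
    · exact div_nonneg (Nat.cast_nonneg _) (by linarith)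
    · rw [div_le_div_iff₀ (by linarith) (by linarith)]
      have : (0 : ℝ) ≤ k := Nat.cast_nonneg _
      nlinarith
  have hsub : ((outSets n k).filter fun S => t ≤ (arcs S ∩ Q).card) ⊆
      (Q.powersetCard t).biUnion fun T => (outSets n k).filter fun S => T ⊆ arcs S := by
    intro S hS
    rw [Finset.mem_filter] at hS
    obtain ⟨T, hTs, hTc⟩ := Finset.exists_subset_card_eq hS.2
    rw [Finset.mem_biUnion]
    exact ⟨T, Finset.mem_powersetCard.2 ⟨hTs.trans Finset.inter_subset_right, hTc⟩,
      Finset.mem_filter.2 ⟨hS.1, hTs.trans Finset.inter_subset_left⟩⟩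
  calc (((outSets n k).filter fun S => t ≤ (arcs S ∩ Q).card).card : ℝ)
      ≤ ∑ T ∈ Q.powersetCard t, (((outSets n k).filter fun S => T ⊆ arcs S).card : ℝ) := by
        exact_mod_cast (Finset.card_le_card hsub).trans Finset.card_biUnion_le
    _ ≤ ∑ T ∈ Q.powersetCard t, (2 * k / n : ℝ) ^ t * (outSets n k).card :=
        Finset.sum_le_sum hT
    _ = (Q.card.choose t : ℝ) * ((2 * k / n : ℝ) ^ t * (outSets n k).card) := by
        rw [Finset.sum_const, Finset.card_powersetCard, nsmul_eq_mul]
    _ ≤ (3 * Q.card / t) ^ t * ((2 * k / n : ℝ) ^ t * (outSets n k).card) := by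
        gcongr
        exact choose_le_pow _ ht
    _ = (6 * Q.card * k / (t * n)) ^ t * (outSets n k).card := by
        rw [← mul_assoc, ← mul_pow]
        congr 2
        field_simp
        ring

/-- Union bound over the s-element sets, with s + d the least integer at least (1 + 1/b)s. The
choice of the set costs (3n/s)^s, which s arcs repay up to (18k)^s. The d ≥ s/b surplus arcs each
give a factor 6ks/n ≤ (36k)^(-b), in total at most (36k)^(-s). -/
lemma card_dense_set_le {n k b s : ℕ} (hk : k + 1 ≤ n) (hk1 : 1 ≤ k) (hb : 1 ≤ b) (hs : 1 ≤ s)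
    (hsn : 6 * k * s * (36 * k) ^ b ≤ n) :
    (((outSets n k).filter fun S => ∃ W : Finset (Fin n), W.card = s ∧
      (b + 1) * s ≤ b * (arcs S ∩ W ×ˢ W).card).card : ℝ) ≤
      (1 / 2) ^ s * (outSets n k).card := by
  obtain ⟨t, ht1, ht2⟩ : ∃ t, (b + 1) * s ≤ b * t ∧ ∀ x, (b + 1) * s ≤ b * x → t ≤ x := by
    have h : ∃ t, (b + 1) * s ≤ b * t := ⟨(b + 1) * s, Nat.le_mul_of_pos_left _ hb⟩
    exact ⟨Nat.find h, Nat.find_spec h, fun x hx => Nat.find_min' h hx⟩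
  have hst : s ≤ t := by
    by_contra! h
    nlinarith
  obtain ⟨d, rfl⟩ := Nat.exists_eq_add_of_le hst
  have hbd : s ≤ b * d := by nlinarith
  have hs' : (1 : ℝ) ≤ s := by exact_mod_cast hs
  have hk' : (1 : ℝ) ≤ k := by exact_mod_cast hk1
  have hn' : (1 : ℝ) ≤ n := by exact_mod_cast (by omega : 1 ≤ n)
  have hsn' : 6 * k * s * (36 * k) ^ b ≤ (n : ℝ) := by exact_mod_cast hsn
  have hy : 6 * k * s / (n : ℝ) ≤ (1 / (36 * k)) ^ b := by
    rw [div_le_iff₀ (by linarith), one_div, inv_pow, ← div_eq_inv_mul,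
      le_div_iff₀ (by positivity)]
    exact hsn'
  have hW : ∀ W ∈ (Finset.univ : Finset (Fin n)).powersetCard s,
      (((outSets n k).filter fun S => (b + 1) * s ≤ b * (arcs S ∩ W ×ˢ W).card).card : ℝ) ≤
      (6 * k * s / n) ^ (s + d) * (outSets n k).card := by
    intro W hW
    rw [Finset.mem_powersetCard] at hW
    have hsub : ((outSets n k).filter fun S => (b + 1) * s ≤ b * (arcs S ∩ W ×ˢ W).card) ⊆
        (outSets n k).filter fun S => s + d ≤ (arcs S ∩ W ×ˢ W).card :=
      Finset.monotone_filter_right _ fun S _ hS => ht2 _ hS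
    refine (Nat.cast_le.2 (Finset.card_le_card hsub)).trans
      ((card_many_arcs_le hk (by omega) (by omega) _).trans ?_)
    refine mul_le_mul_of_nonneg_right (pow_le_pow_left₀ (by positivity) ?_ _) (Nat.cast_nonneg _)
    rw [Finset.card_product, hW.2, div_le_div_iff₀ (by positivity) (by positivity)]
    push_cast
    have hd : (0 : ℝ) ≤ d := Nat.cast_nonneg _
    have : (s : ℝ) * s ≤ s * (s + d) := by nlinarith
    calc 6 * ((s : ℝ) * s) * k * n = (s * s) * (6 * k * n) := by ring
      _ ≤ (s * (s + d)) * (6 * k * n) := by gcongr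
      _ = _ := by ring
  have hsub : ((outSets n k).filter fun S => ∃ W : Finset (Fin n), W.card = s ∧
      (b + 1) * s ≤ b * (arcs S ∩ W ×ˢ W).card) ⊆
      ((Finset.univ : Finset (Fin n)).powersetCard s).biUnion fun W =>
        (outSets n k).filter fun S => (b + 1) * s ≤ b * (arcs S ∩ W ×ˢ W).card := by
    intro S hS
    rw [Finset.mem_filter] at hS
    obtain ⟨hS, W, hWs, hWb⟩ := hS
    rw [Finset.mem_biUnion]
    exact ⟨W, Finset.mem_powersetCard.2 ⟨Finset.subset_univ _, hWs⟩,
      Finset.mem_filter.2 ⟨hS, hWb⟩⟩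
  have hfin : (3 * n / s : ℝ) ^ s * (6 * k * s / n) ^ (s + d) ≤ (1 / 2) ^ s := by
    calc (3 * n / s : ℝ) ^ s * (6 * k * s / n) ^ (s + d)
        = (18 * k) ^ s * (6 * k * s / n) ^ d := by
          rw [pow_add, ← mul_assoc, ← mul_pow]
          congr 2
          field_simp
          norm_num
      _ ≤ (18 * k) ^ s * ((1 / (36 * k)) ^ b) ^ d := by gcongr
      _ = (18 * k) ^ s * (1 / (36 * k)) ^ (b * d) := by rw [← pow_mul]
      _ ≤ (18 * k) ^ s * (1 / (36 * k)) ^ s := by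
          refine mul_le_mul_of_nonneg_left ?_ (by positivity)
          refine pow_le_pow_of_le_one (by positivity) ?_ hbd
          rw [div_le_one (by positivity)]
          linarith
      _ = (1 / 2) ^ s := by
          rw [← mul_pow]
          congr 1
          field_simp
          norm_num
  calc _ ≤ ∑ W ∈ (Finset.univ : Finset (Fin n)).powersetCard s, (((outSets n k).filter fun S =>
        (b + 1) * s ≤ b * (arcs S ∩ W ×ˢ W).card).card : ℝ) := by
        exact_mod_cast (Finset.card_le_card hsub).trans Finset.card_biUnion_le
    _ ≤ ∑ W ∈ (Finset.univ : Finset (Fin n)).powersetCard s,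
        (6 * k * s / n : ℝ) ^ (s + d) * (outSets n k).card := Finset.sum_le_sum hW
    _ = (n.choose s : ℝ) * ((6 * k * s / n : ℝ) ^ (s + d) * (outSets n k).card) := by
        rw [Finset.sum_const, Finset.card_powersetCard, nsmul_eq_mul, Finset.card_univ,
          Fintype.card_fin]
    _ ≤ (3 * n / s) ^ s * ((6 * k * s / n : ℝ) ^ (s + d) * (outSets n k).card) := by
        gcongr
        exact choose_le_pow _ hs
    _ ≤ _ := by
        rw [← mul_assoc]
        gcongr

/-- There are at most 2^n sets `X`, and the smallness of `X` makes each fail with probability at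
most 4^(-n): at least n/q arcs are required, at a cost of 4^(-q) each. -/
lemma card_large_in_degree_le {n k q : ℕ} (hk : k + 1 ≤ n) (hk1 : 1 ≤ k) (hq : 1 ≤ q) :
    (((outSets n k).filter fun S => ∃ X : Finset (Fin n), 6 * k * q * 4 ^ q * X.card ≤ n ∧
      n ≤ q * (arcs S ∩ Finset.univ ×ˢ X).card).card : ℝ) ≤
      (1 / 2) ^ n * (outSets n k).card := by
  classical
  obtain ⟨t, ht1, ht2⟩ : ∃ t, n ≤ q * t ∧ ∀ x, n ≤ q * x → t ≤ x := by
    have h : ∃ t, n ≤ q * t := ⟨n, Nat.le_mul_of_pos_left _ hq⟩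
    exact ⟨Nat.find h, Nat.find_spec h, fun x hx => Nat.find_min' h hx⟩
  have ht : 1 ≤ t := by
    rcases Nat.eq_zero_or_pos t with rfl | h
    · omega
    · exact h
  have ht' : (1 : ℝ) ≤ t := by exact_mod_cast ht
  have hk' : (1 : ℝ) ≤ k := by exact_mod_cast hk1
  have hq' : (1 : ℝ) ≤ q := by exact_mod_cast hq
  have hn' : (1 : ℝ) ≤ n := by exact_mod_cast (by omega : 1 ≤ n)
  set F := (Finset.univ : Finset (Finset (Fin n))).filter
    fun X => 6 * k * q * 4 ^ q * X.card ≤ n with hF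
  have hX : ∀ X ∈ F, (((outSets n k).filter fun S =>
      n ≤ q * (arcs S ∩ Finset.univ ×ˢ X).card).card : ℝ) ≤
      (1 / 4) ^ n * (outSets n k).card := by
    intro X hX
    have hXn : 6 * k * q * 4 ^ q * X.card ≤ (n : ℝ) := by
      exact_mod_cast (Finset.mem_filter.1 hX).2
    have hsub : ((outSets n k).filter fun S => n ≤ q * (arcs S ∩ Finset.univ ×ˢ X).card) ⊆
        (outSets n k).filter fun S => t ≤ (arcs S ∩ Finset.univ ×ˢ X).card :=
      Finset.monotone_filter_right _ fun S _ hS => ht2 _ hS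
    refine (Nat.cast_le.2 (Finset.card_le_card hsub)).trans
      ((card_many_arcs_le hk (by omega) ht _).trans ?_)
    refine mul_le_mul_of_nonneg_right ?_ (Nat.cast_nonneg _)
    rw [Finset.card_product, Finset.card_univ, Fintype.card_fin]
    have hbase : 6 * ((n * X.card : ℕ) : ℝ) * k / (t * n) ≤ (1 / 4) ^ q := by
      have hqt : (n : ℝ) ≤ q * t := by exact_mod_cast ht1
      have h1 : 6 * k * 4 ^ q * X.card ≤ (t : ℝ) := by
        refine le_of_mul_le_mul_left ?_ (by linarith : (0 : ℝ) < q)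
        linarith
      rw [one_div, inv_pow, div_le_iff₀ (by positivity), ← div_eq_inv_mul,
        le_div_iff₀ (by positivity)]
      push_cast
      nlinarith
    calc (6 * ((n * X.card : ℕ) : ℝ) * k / (t * n)) ^ t ≤ ((1 / 4 : ℝ) ^ q) ^ t :=
          pow_le_pow_left₀ (by positivity) hbase _
      _ = (1 / 4) ^ (q * t) := by rw [← pow_mul]
      _ ≤ (1 / 4) ^ n := pow_le_pow_of_le_one (by norm_num) (by norm_num) ht1
  have hsub : ((outSets n k).filter fun S => ∃ X : Finset (Fin n),
      6 * k * q * 4 ^ q * X.card ≤ n ∧ n ≤ q * (arcs S ∩ Finset.univ ×ˢ X).card) ⊆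
      F.biUnion fun X => (outSets n k).filter fun S =>
        n ≤ q * (arcs S ∩ Finset.univ ×ˢ X).card := by
    intro S hS
    rw [Finset.mem_filter] at hS
    obtain ⟨hS, X, hX1, hX2⟩ := hS
    rw [Finset.mem_biUnion]
    exact ⟨X, Finset.mem_filter.2 ⟨Finset.mem_univ _, hX1⟩, Finset.mem_filter.2 ⟨hS, hX2⟩⟩
  have hFc : (F.card : ℝ) ≤ 2 ^ n := by
    have : F.card ≤ 2 ^ n := by
      refine (Finset.card_filter_le _ _).trans ?_
      rw [Finset.card_univ, Fintype.card_finset, Fintype.card_fin]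
    exact_mod_cast this
  calc _ ≤ ∑ X ∈ F, (((outSets n k).filter fun S =>
        n ≤ q * (arcs S ∩ Finset.univ ×ˢ X).card).card : ℝ) := by
        exact_mod_cast (Finset.card_le_card hsub).trans Finset.card_biUnion_le
    _ ≤ ∑ X ∈ F, (1 / 4 : ℝ) ^ n * (outSets n k).card := Finset.sum_le_sum hX
    _ = F.card * ((1 / 4 : ℝ) ^ n * (outSets n k).card) := by
        rw [Finset.sum_const, nsmul_eq_mul]
    _ ≤ 2 ^ n * ((1 / 4 : ℝ) ^ n * (outSets n k).card) := by gcongr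
    _ = _ := by
        rw [← mul_assoc, ← mul_pow]
        norm_num

/-! ### Monochromatic cycles of linear length -/

/-- If every set of about `k₀` vertices is sparse and no small set has large in-degree, then
every colouring with `r` colours of the `(r + 1)`-out graph has a long monochromatic cycle. -/
lemma hasMonoCycleGE_of_sparse {r n k₀ t M : ℕ} (hr : 1 ≤ r) (D : OutDigraph n (r + 1))
    (hk₀ : 0 < k₀) (hk₀n : 16 * r * k₀ ≤ n) (ht : 2 ≤ t) (hM : 8 * r * (r + 1) ≤ M)
    (htM : 2 * t * M ≤ k₀)
    (hsparse : ∀ W : Finset (Fin n), k₀ ≤ 2 * W.card → W.card ≤ k₀ →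
      4 * r * (arcs (fun v => (D v).1) ∩ W ×ˢ W).card < (4 * r + 1) * W.card)
    (hin : ∀ X : Finset (Fin n), M * X.card ≤ n →
      8 * r * (arcs (fun v => (D v).1) ∩ Finset.univ ×ˢ X).card < n)
    (c : EdgeColouring (outGraph D) r) {ℓ : ℝ} (hℓ : ℓ ≤ t + 1) : HasMonoCycleGE c ℓ := by
  classical
  by_contra hcon
  have hcyc : ∀ (i : Fin r) (y : Fin n) (p : (colourClass c i).Walk y y), p.IsCycle →
      p.length ≤ t := by
    intro i y p hp
    by_contra! h
    refine hcon ⟨i, y, p, hp, hℓ.trans ?_⟩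
    exact_mod_cast h
  set S : Fin n → Finset (Fin n) := fun v => (D v).1 with hS
  have hSm : S ∈ outSets n (r + 1) := out_mem_outSets D
  have hr' : (1 : ℝ) ≤ r := by exact_mod_cast hr
  have hk₀le : k₀ ≤ n := by nlinarith
  have hsp : ∀ W : Finset (Fin n), k₀ ≤ 2 * W.card → W.card ≤ k₀ →
      ((arcs S ∩ W ×ˢ W).card : ℝ) ≤ (1 + 1 / (4 * r)) * W.card := by
    intro W h1 h2
    have h3 : 4 * r * ((arcs S ∩ W ×ˢ W).card : ℝ) ≤ (4 * r + 1) * W.card := by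
      exact_mod_cast (hsparse W h1 h2).le
    have h4 : (1 + 1 / (4 * r) : ℝ) * W.card = ((4 * r + 1) * W.card) / (4 * r) := by
      field_simp
    rw [h4, le_div_iff₀ (by positivity)]
    linarith
  let A : Fin r → Finset (Fin n × Fin n) := fun i =>
    (arcs S).filter fun e => ∃ h : e ∈ E(outGraph D), c ⟨e, h⟩ = i
  have hAsub : ∀ i (W : Finset (Fin n)),
      ((A i).filter fun e => e.1 ∈ W ∧ e.2 ∈ W) ⊆ arcs S ∩ W ×ˢ W := by
    intro i W e he
    rw [Finset.mem_filter] at he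
    exact Finset.mem_inter.2 ⟨(Finset.mem_filter.1 he.1).1, Finset.mem_product.2 he.2⟩
  have hA : ∀ i, ((A i).card : ℝ) * r < n * (r + 1) := by
    intro i
    obtain ⟨X, hX, hXe⟩ := exists_fragmentation (colourClass c i) ht hk₀ (hcyc i) (A i)
      (by
        intro e he hne
        obtain ⟨h, hc⟩ := (Finset.mem_filter.1 he).2
        exact ⟨hne, ⟨e, h⟩, hc, h, Or.inl rfl⟩)
      (c := 1 + 1 / (4 * r)) (by positivity)
      (fun W h1 h2 => (Nat.cast_le.2 (Finset.card_le_card (hAsub i W))).trans (hsp W h1 h2))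
      -- A set too small for `hsp` is enlarged to exactly k₀ vertices.
      (fun W hW => by
        obtain ⟨W', hWW', -, hW'⟩ := Finset.exists_subsuperset_card_eq (Finset.subset_univ W) hW
          (by rw [Finset.card_univ, Fintype.card_fin]; exact hk₀le)
        have := hsp W' (by omega) hW'.le
        rw [hW'] at this
        refine le_trans (Nat.cast_le.2 (Finset.card_le_card ((hAsub i W).trans ?_))) this
        exact Finset.inter_subset_inter subset_rfl (Finset.product_subset_product hWW' hWW'))
      n Finset.univ (by simp)
    rw [Finset.card_univ, Fintype.card_fin] at hX hXe
    have hMX : M * X.card ≤ n := by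
      refine Nat.le_of_mul_le_mul_right ?_ hk₀
      calc M * X.card * k₀ = M * (X.card * k₀) := by ring
        _ ≤ M * (2 * t * n) := by gcongr
        _ = (2 * t * M) * n := by ring
        _ ≤ k₀ * n := by gcongr
        _ = n * k₀ := by ring
    have hinX := hin X hMX
    have hout : (arcs S ∩ X ×ˢ Finset.univ).card ≤ (r + 1) * X.card := by
      rw [card_eq_sum_card_sections]
      have : ∀ v, (Finset.univ.filter fun w => (v, w) ∈ arcs S ∩ X ×ˢ Finset.univ).card ≤
          if v ∈ X then r + 1 else 0 := by
        intro v
        split_ifs with hv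
        · rw [← (mem_outSets.1 hSm v).2]
          refine Finset.card_le_card fun w hw => ?_
          simp only [Finset.mem_filter, Finset.mem_inter] at hw
          exact mem_arcs.1 hw.2.1
        · rw [Nat.le_zero, Finset.card_eq_zero, Finset.filter_eq_empty_iff]
          intro w _ hw
          simp only [Finset.mem_inter, Finset.mem_product] at hw
          exact hv hw.2.1
      refine (Finset.sum_le_sum fun v _ => this v).trans ?_
      rw [← Finset.sum_filter, Finset.sum_const, smul_eq_mul, mul_comm]
      simp
    have hsub : A i ⊆ ((A i).filter fun e => e.1 ∈ Finset.univ \ X ∧ e.2 ∈ Finset.univ \ X) ∪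
        ((arcs S ∩ X ×ˢ Finset.univ) ∪ (arcs S ∩ Finset.univ ×ˢ X)) := by
      intro e he
      have heS := (Finset.mem_filter.1 he).1
      simp only [Finset.mem_union, Finset.mem_filter, Finset.mem_inter, Finset.mem_product,
        Finset.mem_sdiff, Finset.mem_univ, true_and, and_true]
      tauto
    have hle : ((A i).card : ℝ) ≤
        (((A i).filter fun e => e.1 ∈ Finset.univ \ X ∧ e.2 ∈ Finset.univ \ X).card : ℝ) +
        ((arcs S ∩ X ×ˢ Finset.univ).card + (arcs S ∩ Finset.univ ×ˢ X).card) := by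
      exact_mod_cast (Finset.card_le_card hsub).trans ((Finset.card_union_le _ _).trans
        (Nat.add_le_add_left (Finset.card_union_le _ _) _))
    have hn' : (0 : ℝ) < n := by
      have : 0 < n := by omega
      exact_mod_cast this
    have e1 : ((arcs S ∩ X ×ˢ Finset.univ).card : ℝ) * (8 * r) ≤ n := by
      have : (arcs S ∩ X ×ˢ Finset.univ).card * (8 * r) ≤ n :=
        calc _ ≤ ((r + 1) * X.card) * (8 * r) := by gcongr
          _ = (8 * r * (r + 1)) * X.card := by ring
          _ ≤ M * X.card := by gcongr
          _ ≤ n := hMX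
      exact_mod_cast this
    have e2 : (8 * r) * ((arcs S ∩ Finset.univ ×ˢ X).card : ℝ) < n := by exact_mod_cast hinX
    have e3 : 16 * r * (k₀ : ℝ) ≤ n := by exact_mod_cast hk₀n
    -- Budget of one colour: (1 + 1/(4r))(n + k₀) arcs inside the pieces, with k₀ ≤ n/(16r), at most
    -- n/(8r) arcs leaving `X` and fewer than n/(8r) entering it. The total is below (1 + 1/r)n.
    have e4 : (1 + 1 / (4 * r) : ℝ) * n + (1 + 1 / (4 * r)) * k₀ =
        (8 * r * n + 2 * n + (8 * r * k₀ + 2 * k₀)) / (8 * r) := by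
      field_simp
      ring
    rw [e4] at hXe
    have h5 := mul_le_mul_of_nonneg_right (hle.trans (add_le_add_left hXe _))
      (by positivity : (0 : ℝ) ≤ 8 * r)
    rw [add_mul, div_mul_cancel₀ _ (by positivity)] at h5
    have hk₀r : (k₀ : ℝ) ≤ r * k₀ := le_mul_of_one_le_left (Nat.cast_nonneg _) hr'
    nlinarith
  have htot : (arcs S).card ≤ ∑ i, (A i).card := by
    refine le_trans (Finset.card_le_card ?_) Finset.card_biUnion_le
    intro e he
    rw [Finset.mem_biUnion]
    have hE : e ∈ E(outGraph D) := mem_arcs.1 he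
    exact ⟨c ⟨e, hE⟩, Finset.mem_univ _, Finset.mem_filter.2 ⟨he, hE, rfl⟩⟩
  rw [card_arcs hSm] at htot
  have htot' : (n : ℝ) * (r + 1) ≤ ∑ i, ((A i).card : ℝ) := by exact_mod_cast htot
  have hlt : ∑ i, ((A i).card : ℝ) * r < ∑ _i : Fin r, (n : ℝ) * (r + 1) :=
    Finset.sum_lt_sum_of_nonempty ⟨⟨0, hr⟩, Finset.mem_univ _⟩ fun i _ => hA i
  rw [← Finset.sum_mul, Finset.sum_const, Finset.card_univ, Fintype.card_fin, nsmul_eq_mul] at hlt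
  nlinarith

/-- `B` is dictated by `card_dense_set_le` with b = 4r and `M` by `card_large_in_degree_le` with q =
8r. With k₀ = n/B and t = k₀/(2M), rounded down, this gives γ = 1/(2MB). Summing over the sizes from
k₀/2 to k₀ gives a geometric tail that vanishes because k₀ grows with n. -/
lemma exists_tendsto_long_cycle {r : ℕ} (hr : 1 ≤ r) :
    ∃ γ : ℝ, 0 < γ ∧ Tendsto (fun n : ℕ => outLaw n (r + 1)
      {D | ∀ c : EdgeColouring (outGraph D) r, HasMonoCycleGE c (γ * n)}) atTop (𝓝 1) := by
  classical
  set k := r + 1 with hk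
  set B := 6 * k * (36 * k) ^ (4 * r) with hB
  set M := 6 * k * (8 * r) * 4 ^ (8 * r) with hM
  have hBpos : 0 < B := by positivity
  have hMpos : 0 < M := by positivity
  have hBr : 16 * r ≤ B := by
    have h1 : 36 * k ≤ (36 * k) ^ (4 * r) := Nat.le_self_pow (by omega) _
    have h2 : 6 * k * (36 * k) ≤ B := Nat.mul_le_mul_left _ h1
    nlinarith
  have hMr : 8 * r * (r + 1) ≤ M := by
    have h1 : 1 ≤ 4 ^ (8 * r) := Nat.one_le_pow _ _ (by norm_num)
    calc 8 * r * (r + 1) ≤ 6 * k * (8 * r) * 1 := by rw [hk]; nlinarith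
      _ ≤ M := Nat.mul_le_mul_left _ h1
  refine ⟨1 / (2 * M * B), by positivity, tendsto_outLaw_one _ fun θ hθ => ?_⟩
  have hkB : Tendsto (fun n : ℕ => (n / B + 1) / 2) atTop atTop := by
    refine tendsto_atTop_mono (f := fun n => n / (B * 2)) (fun n => ?_)
      (Nat.tendsto_div_const_atTop (by positivity))
    rw [← Nat.div_div_eq_div_mul]
    exact Nat.div_le_div_right (Nat.le_succ _)
  have hlim : Tendsto (fun n : ℕ => (2 : ℝ) * (1 / 2) ^ ((n / B + 1) / 2) + (1 / 2) ^ n) atTop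
      (𝓝 (2 * 0 + 0)) := by
    have h := tendsto_pow_atTop_nhds_zero_of_lt_one (r := (1 / 2 : ℝ)) (by norm_num) (by norm_num)
    exact ((h.comp hkB).const_mul 2).add h
  rw [mul_zero, add_zero] at hlim
  filter_upwards [hlim.eventually (gt_mem_nhds hθ), eventually_ge_atTop (2 * (2 * M) * B),
    eventually_ge_atTop (k + 1)] with n hn hnB hnk
  have hk₀B : n / B * B ≤ n := Nat.div_mul_le_self _ _
  have hk₀M : 2 * (2 * M) ≤ n / B := (Nat.le_div_iff_mul_le hBpos).2 hnB
  set k₀ := n / B with hk₀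
  let bad₁ : ℕ → (Fin n → Finset (Fin n)) → Prop := fun s S => ∃ W : Finset (Fin n),
    W.card = s ∧ (4 * r + 1) * s ≤ 4 * r * (arcs S ∩ W ×ˢ W).card
  let bad₂ : (Fin n → Finset (Fin n)) → Prop := fun S => ∃ X : Finset (Fin n),
    M * X.card ≤ n ∧ n ≤ 8 * r * (arcs S ∩ Finset.univ ×ˢ X).card
  refine ⟨((Finset.Ico ((k₀ + 1) / 2) (k₀ + 1)).biUnion fun s => (outSets n k).filter (bad₁ s)) ∪
    (outSets n k).filter bad₂, ?_, ?_⟩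
  · intro D hD
    by_contra hcon
    simp only [Finset.mem_union, Finset.mem_biUnion, Finset.mem_filter, out_mem_outSets D,
      true_and, not_or] at hcon
    refine hD fun c => ?_
    refine hasMonoCycleGE_of_sparse (k₀ := k₀) (t := k₀ / (2 * M)) (M := M) hr D
      (by omega) ?_ ?_ hMr ?_ ?_ ?_ c ?_
    · calc 16 * r * k₀ ≤ B * k₀ := by gcongr
        _ = k₀ * B := mul_comm _ _
        _ ≤ n := hk₀B
    · exact (Nat.le_div_iff_mul_le (by positivity)).2 hk₀M
    · have := Nat.div_mul_le_self k₀ (2 * M)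
      linarith
    · intro W h1 h2
      by_contra! h
      exact hcon.1 ⟨W.card, Finset.mem_Ico.2 ⟨by omega, by omega⟩, W, rfl, h⟩
    · intro X hX
      by_contra! h
      exact hcon.2 ⟨X, hX, h⟩
    · have h1 : n < (k₀ / (2 * M) + 1) * (2 * M * B) := by
        have e : k₀ / (2 * M) = n / (2 * M * B) := by
          rw [hk₀, Nat.div_div_eq_div_mul, mul_comm B]
        rw [e, mul_comm]
        exact Nat.lt_mul_div_succ _ (by positivity)
      have h2 : (n : ℝ) ≤ ((k₀ / (2 * M) : ℕ) + 1) * (2 * M * B) := by exact_mod_cast h1.le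
      rw [one_div, ← div_eq_inv_mul, div_le_iff₀ (by positivity)]
      exact h2
  · have h1 : ∀ s ∈ Finset.Ico ((k₀ + 1) / 2) (k₀ + 1),
        (((outSets n k).filter (bad₁ s)).card : ℝ) ≤ (1 / 2) ^ s * (outSets n k).card := by
      intro s hs
      rw [Finset.mem_Ico] at hs
      refine card_dense_set_le hnk (by omega) (by omega) (by omega) ?_
      calc 6 * k * s * (36 * k) ^ (4 * r) = s * B := by rw [hB]; ring
        _ ≤ k₀ * B := by gcongr; omega
        _ ≤ n := hk₀B
    have h2 : (((outSets n k).filter bad₂).card : ℝ) ≤ (1 / 2) ^ n * (outSets n k).card :=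
      card_large_in_degree_le hnk (by omega) (by omega)
    have h3 : ∑ s ∈ Finset.Ico ((k₀ + 1) / 2) (k₀ + 1), (1 / 2 : ℝ) ^ s ≤
        2 * (1 / 2) ^ ((k₀ + 1) / 2) := by
      refine (geom_sum_Ico_le_of_lt_one (by norm_num) (by norm_num)).trans (le_of_eq ?_)
      norm_num
      ring
    calc _ ≤ ∑ s ∈ Finset.Ico ((k₀ + 1) / 2) (k₀ + 1),
          (((outSets n k).filter (bad₁ s)).card : ℝ) + ((outSets n k).filter bad₂).card := by
          rw [← Nat.cast_sum, ← Nat.cast_add, Nat.cast_le]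
          exact (Finset.card_union_le _ _).trans (Nat.add_le_add_right Finset.card_biUnion_le _)
      _ ≤ ∑ s ∈ Finset.Ico ((k₀ + 1) / 2) (k₀ + 1), (1 / 2 : ℝ) ^ s * (outSets n k).card +
          (1 / 2) ^ n * (outSets n k).card := add_le_add (Finset.sum_le_sum h1) h2
      _ = (∑ s ∈ Finset.Ico ((k₀ + 1) / 2) (k₀ + 1), (1 / 2 : ℝ) ^ s + (1 / 2) ^ n) *
          (outSets n k).card := by rw [← Finset.sum_mul, add_mul]
      _ ≤ θ * (outSets n k).card := by
          gcongr
          linarith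

/-! ### Connectivity in functional graphs -/

lemma sum_comm_four {ι κ : Type*} (s t : Finset ι) (s' t' : Finset κ) (F : ι → ι → κ → κ → ℝ) :
    ∑ u ∈ s, ∑ v ∈ t, ∑ a ∈ s', ∑ b ∈ t', F u v a b =
      ∑ a ∈ s', ∑ b ∈ t', ∑ u ∈ s, ∑ v ∈ t, F u v a b := by
  calc _ = ∑ u ∈ s, ∑ a ∈ s', ∑ v ∈ t, ∑ b ∈ t', F u v a b :=
        Finset.sum_congr rfl fun u _ => Finset.sum_comm
    _ = ∑ a ∈ s', ∑ u ∈ s, ∑ v ∈ t, ∑ b ∈ t', F u v a b := Finset.sum_comm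
    _ = ∑ a ∈ s', ∑ u ∈ s, ∑ b ∈ t', ∑ v ∈ t, F u v a b :=
        Finset.sum_congr rfl fun a _ => Finset.sum_congr rfl fun u _ => Finset.sum_comm
    _ = _ := Finset.sum_congr rfl fun a _ => Finset.sum_comm

section FunctionalGraph

variable {V : Type*}

/-- The edges `{x, f x}` of the functional graph of `f` for which `B x (f x)` holds. -/
def funGraph (f : V → V) (B : V → V → Prop) : SimpleGraph V where
  Adj x y := x ≠ y ∧ ((B x (f x) ∧ f x = y) ∨ (B y (f y) ∧ f y = x))
  symm := ⟨fun _ _ h => ⟨h.1.symm, h.2.symm⟩⟩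
  loopless := ⟨fun _ h => h.1 rfl⟩

/-- The first `a` arcs of the orbit of `u` are kept. -/
def Kept (f : V → V) (B : V → V → Prop) (a : ℕ) (u : V) : Prop :=
  ∀ i < a, B (f^[i] u) (f (f^[i] u))

/-- The orbits of `u` and `v` along kept arcs meet after `a` and `b` steps. -/
def Joins (f : V → V) (B : V → V → Prop) (a b : ℕ) (u v : V) : Prop :=
  f^[a] u = f^[b] v ∧ Kept f B a u ∧ Kept f B b v

lemma Joins.symm {f : V → V} {B : V → V → Prop} {a b : ℕ} {u v : V} (h : Joins f B a b u v) :
    Joins f B b a v u := ⟨h.1.symm, h.2.2, h.2.1⟩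

lemma Joins.trans_of_le {f : V → V} {B : V → V → Prop} {a b c d : ℕ} {u v w : V}
    (h : Joins f B a b u v) (h' : Joins f B c d v w) (hbc : b ≤ c) :
    Joins f B ((c - b) + a) d u w := by
  obtain ⟨e, rfl⟩ := Nat.exists_eq_add_of_le hbc
  rw [Nat.add_sub_cancel_left]
  refine ⟨?_, ?_, h'.2.2⟩
  · rw [Function.iterate_add_apply, h.1, ← Function.iterate_add_apply, add_comm e b]
    exact h'.1
  · intro i hi
    by_cases hia : i < a
    · exact h.2.1 i hia
    · obtain ⟨j, rfl⟩ := Nat.exists_eq_add_of_le (not_lt.1 hia)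
      have := h'.2.1 (j + b) (by omega)
      rwa [Function.iterate_add_apply, ← h.1, ← Function.iterate_add_apply, add_comm] at this

/-- Each vertex has a single out-arc, so any walk folds into two forward orbits with a common end.
-/
lemma exists_joins_of_reachable {f : V → V} {B : V → V → Prop} {u v : V}
    (h : (funGraph f B).Reachable u v) : ∃ a b, Joins f B a b u v := by
  obtain ⟨p⟩ := h
  induction p with
  | nil => exact ⟨0, 0, rfl, fun i hi => absurd hi (Nat.not_lt_zero _),
      fun i hi => absurd hi (Nat.not_lt_zero _)⟩
  | @cons x y z hadj p ih =>
    obtain ⟨c, d, hcd⟩ := ih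
    have h1 : ∃ a b, Joins f B a b x y := by
      rcases hadj.2 with ⟨hB, hf⟩ | ⟨hB, hf⟩
      · refine ⟨1, 0, hf, fun i hi => ?_, fun i hi => absurd hi (Nat.not_lt_zero _)⟩
        obtain rfl : i = 0 := by omega
        exact hB
      · refine ⟨0, 1, hf.symm, fun i hi => absurd hi (Nat.not_lt_zero _), fun i hi => ?_⟩
        obtain rfl : i = 0 := by omega
        exact hB
    obtain ⟨a, b, hab⟩ := h1
    rcases le_total b c with hbc | hbc
    · exact ⟨_, _, hab.trans_of_le hcd hbc⟩
    · exact ⟨_, _, (hcd.symm.trans_of_le hab.symm hbc).symm⟩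

lemma Kept.tail {f : V → V} {B : V → V → Prop} {b : ℕ} {v : V} (h : Kept f B (b + 1) v) :
    Kept f B b (f v) := fun i hi => by
  have := h (i + 1) (by omega)
  rwa [Function.iterate_succ_apply] at this

/-- A repetition would allow a loop to be cut out of the orbit. -/
lemma Joins.distinct {f : V → V} {B : V → V → Prop} {a b : ℕ} {u v : V}
    (h : Joins f B a b u v) (hmin : ∀ a' b', Joins f B a' b' u v → a + b ≤ a' + b') :
    ∀ i j, i < j → j < a → f^[i] u ≠ f^[j] u := by
  intro i j hij hj heq
  have : Joins f B ((a - j) + i) b u v := by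
    refine ⟨?_, fun m hm => h.2.1 m (by omega), h.2.2⟩
    rw [Function.iterate_add_apply, heq, ← Function.iterate_add_apply,
      Nat.sub_add_cancel hj.le, h.1]
  have := hmin _ _ this
  omega

variable [DecidableEq V]

/-- There are `b` steps from `v` to `u` along kept arcs with distinct sources outside `A`. -/
def Reach (f : V → V) (B : V → V → Prop) : ℕ → Finset V → V → V → Prop
  | 0, _, v, u => v = u
  | b + 1, A, v, u => v ∉ A ∧ B v (f v) ∧ Reach f B b (insert v A) (f v) u

/-- The orbits of `u` and `v` meet after `a` and `b` steps along kept arcs with distinct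
sources outside `A`. -/
def Meet (f : V → V) (B : V → V → Prop) (b : ℕ) : ℕ → Finset V → V → V → Prop
  | 0, A, u, v => Reach f B b A v u
  | a + 1, A, u, v => u ∉ A ∧ B u (f u) ∧ Meet f B b a (insert u A) (f u) v

lemma Reach.mono {f : V → V} {B : V → V → Prop} : ∀ {b : ℕ} {A A' : Finset V} {v u : V},
    A ⊆ A' → Reach f B b A' v u → Reach f B b A v u
  | 0, _, _, _, _, _, h => h
  | _ + 1, _, _, _, _, hA, h =>
    ⟨fun hv => h.1 (hA hv), h.2.1, h.2.2.mono (Finset.insert_subset_insert _ hA)⟩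

lemma Meet.mono {f : V → V} {B : V → V → Prop} {b : ℕ} : ∀ {a : ℕ} {A A' : Finset V} {u v : V},
    A ⊆ A' → Meet f B b a A' u v → Meet f B b a A u v
  | 0, _, _, _, _, hA, h => Reach.mono hA h
  | _ + 1, _, _, _, _, hA, h =>
    ⟨fun hv => h.1 (hA hv), h.2.1, h.2.2.mono (Finset.insert_subset_insert _ hA)⟩

/-- Sources in `A` are forbidden, so the values of the function on `A` are never consulted. This is
the independence that allows arcs to be exposed one at a time. -/
lemma Reach.congr {f g : V → V} {B : V → V → Prop} : ∀ {b : ℕ} {A : Finset V} {v u : V},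
    (∀ x ∉ A, f x = g x) → Reach f B b A v u → Reach g B b A v u
  | 0, _, _, _, _, h => h
  | _ + 1, _, v, _, hfg, h => by
    refine ⟨h.1, hfg v h.1 ▸ h.2.1, ?_⟩
    rw [← hfg v h.1]
    exact h.2.2.congr fun x hx => hfg x fun hxA => hx (Finset.mem_insert_of_mem hxA)

lemma Meet.congr {f g : V → V} {B : V → V → Prop} {b : ℕ} : ∀ {a : ℕ} {A : Finset V} {u v : V},
    (∀ x ∉ A, f x = g x) → Meet f B b a A u v → Meet g B b a A u v
  | 0, _, _, _, hfg, h => Reach.congr hfg h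
  | _ + 1, _, u, _, hfg, h => by
    refine ⟨h.1, hfg u h.1 ▸ h.2.1, ?_⟩
    rw [← hfg u h.1]
    exact h.2.2.congr fun x hx => hfg x fun hxA => hx (Finset.mem_insert_of_mem hxA)

lemma Reach.card_le [Fintype V] {f : V → V} {B : V → V → Prop} :
    ∀ {b : ℕ} {A : Finset V} {v u : V}, Reach f B b A v u → b + A.card ≤ Fintype.card V
  | 0, A, _, _, _ => by simpa using A.card_le_univ
  | b + 1, A, v, u, h => by
    have := h.2.2.card_le
    rw [Finset.card_insert_of_notMem h.1] at this
    omega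

lemma Meet.card_le [Fintype V] {f : V → V} {B : V → V → Prop} {b : ℕ} :
    ∀ {a : ℕ} {A : Finset V} {u v : V}, Meet f B b a A u v → a + b + A.card ≤ Fintype.card V
  | 0, A, _, _, h => by simpa using Reach.card_le h
  | a + 1, A, u, v, h => by
    have := h.2.2.card_le
    rw [Finset.card_insert_of_notMem h.1] at this
    omega

lemma reach_of_kept {f : V → V} {B : V → V → Prop} : ∀ {b : ℕ} {A : Finset V} {v : V},
    Kept f B b v → (∀ j < b, f^[j] v ∉ A) → (∀ i j, i < j → j < b → f^[i] v ≠ f^[j] v) →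
    Reach f B b A v (f^[b] v)
  | 0, _, _, _, _, _ => rfl
  | b + 1, A, v, hk, hA, hd => by
    refine ⟨hA 0 (by omega), hk 0 (by omega), ?_⟩
    rw [Function.iterate_succ_apply]
    refine reach_of_kept hk.tail (fun j hj => ?_) fun i j hij hj => ?_
    · rw [← Function.iterate_succ_apply, Finset.mem_insert, not_or]
      exact ⟨(hd 0 (j + 1) (by omega) (by omega)).symm, hA _ (by omega)⟩
    · exact hd (i + 1) (j + 1) (by omega) (by omega)

lemma meet_of_kept {f : V → V} {B : V → V → Prop} {b : ℕ} {v : V} (hv : Kept f B b v)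
    (hvd : ∀ i j, i < j → j < b → f^[i] v ≠ f^[j] v) : ∀ {a : ℕ} {A : Finset V} {u : V},
    f^[a] u = f^[b] v → Kept f B a u → (∀ j < b, f^[j] v ∉ A) → (∀ j < a, f^[j] u ∉ A) →
    (∀ i j, i < j → j < a → f^[i] u ≠ f^[j] u) → (∀ i j, i < a → j < b → f^[i] u ≠ f^[j] v) →
    Meet f B b a A u v
  | 0, A, u, h, _, hA, _, _, _ => by
    have : u = f^[b] v := h
    subst this
    exact reach_of_kept hv hA hvd
  | a + 1, A, u, h, hu, hvA, huA, hud, huv => by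
    refine ⟨huA 0 (by omega), hu 0 (by omega), ?_⟩
    refine meet_of_kept hv hvd h hu.tail (fun j hj => ?_) (fun j hj => ?_)
      (fun i j hij hj => ?_) fun i j hi hj => ?_
    · rw [Finset.mem_insert, not_or]
      exact ⟨(huv 0 j (by omega) hj).symm, hvA j hj⟩
    · rw [← Function.iterate_succ_apply, Finset.mem_insert, not_or]
      exact ⟨(hud 0 (j + 1) (by omega) (by omega)).symm, huA _ (by omega)⟩
    · exact hud (i + 1) (j + 1) (by omega) (by omega)
    · exact huv (i + 1) j (by omega) hj

/-- When a + b is minimal all sources are distinct: a repetition within one orbit can be cut out,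
and a coincidence between the orbits is an earlier meeting. -/
lemma exists_meet_of_reachable {f : V → V} {B : V → V → Prop} {u v : V}
    (h : (funGraph f B).Reachable u v) : ∃ a b, Meet f B b a ∅ u v := by
  classical
  have hex : ∃ m a b, a + b = m ∧ Joins f B a b u v := by
    obtain ⟨a, b, hab⟩ := exists_joins_of_reachable h
    exact ⟨_, a, b, rfl, hab⟩
  obtain ⟨a, b, hsum, hab⟩ := Nat.find_spec hex
  have hmin : ∀ a' b', Joins f B a' b' u v → a + b ≤ a' + b' := fun a' b' h' => by
    rw [hsum]
    exact Nat.find_min' hex ⟨a', b', rfl, h'⟩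
  refine ⟨a, b, meet_of_kept hab.2.2 ?_ hab.1 hab.2.1 (by simp) (by simp)
    (hab.distinct hmin) ?_⟩
  · exact hab.symm.distinct fun a' b' h' => by
      have := hmin _ _ h'.symm
      omega
  · intro i j hi hj heq
    have := hmin i j ⟨heq, fun m hm => hab.2.1 m (by omega), fun m hm => hab.2.2 m (by omega)⟩
    omega

variable {Y : Type*}

lemma reach_update {b : ℕ} {A : Finset V} {B : V → V → Prop} {u v y : V} {φ : Y → V} {ω : V → Y} {z : Y}
    (h : Reach (fun x => φ (ω x)) B b (insert u A) y v) :
    Reach (fun x => φ (Function.update ω u z x)) B b (insert u A) y v := by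
  refine h.congr fun x hx => ?_
  have hxu : x ≠ u := fun hxu => hx (hxu ▸ Finset.mem_insert_self u A)
  rw [Function.update_of_ne hxu]

lemma meet_update {a b : ℕ} {A : Finset V} {B : V → V → Prop} {u v y : V} {φ : Y → V} {ω : V → Y} {z : Y}
    (h : Meet (fun x => φ (ω x)) B b a (insert u A) y v) :
    Meet (fun x => φ (Function.update ω u z x)) B b a (insert u A) y v := by
  refine h.congr fun x hx => ?_
  have hxu : x ≠ u := fun hxu => hx (hxu ▸ Finset.mem_insert_self u A)
  rw [Function.update_of_ne hxu]

end FunctionalGraph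

/-! ### Expected component sizes by exploration -/

section Exploration

variable {V Y : Type*} [Fintype V] [DecidableEq V]

open Classical in
/-- The number of points of a finite product with a given property, as a real number. -/
noncomputable def numOf (Z : V → Finset Y) (E : (V → Y) → Prop) : ℝ :=
  ((Fintype.piFinset Z).filter E).card

lemma numOf_nonneg (Z : V → Finset Y) (E : (V → Y) → Prop) : 0 ≤ numOf Z E := Nat.cast_nonneg _

lemma numOf_mono {Z : V → Finset Y} {E E' : (V → Y) → Prop} (h : ∀ ω, E ω → E' ω) :
    numOf Z E ≤ numOf Z E' := by
  classical
  refine Nat.cast_le.2 (Finset.card_le_card fun ω hω => ?_)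
  rw [Finset.mem_filter] at hω ⊢
  exact ⟨hω.1, h ω hω.2⟩

lemma numOf_le_card (Z : V → Finset Y) (E : (V → Y) → Prop) :
    numOf Z E ≤ (Fintype.piFinset Z).card := by
  classical
  exact Nat.cast_le.2 (Finset.card_le_card fun ω hω => (Finset.mem_filter.1 hω).1)

lemma numOf_le_sum {ι : Type*} {Z : V → Finset Y} {E : (V → Y) → Prop} (s : Finset ι)
    (F : ι → (V → Y) → Prop) (h : ∀ ω, E ω → ∃ i ∈ s, F i ω) :
    numOf Z E ≤ ∑ i ∈ s, numOf Z (F i) := by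
  classical
  have : (Fintype.piFinset Z).filter E ⊆ s.biUnion fun i => (Fintype.piFinset Z).filter (F i) := by
    intro ω hω
    rw [Finset.mem_filter] at hω
    obtain ⟨i, hi, hF⟩ := h ω hω.2
    exact Finset.mem_biUnion.2 ⟨i, hi, Finset.mem_filter.2 ⟨hω.1, hF⟩⟩
  simp only [numOf]
  exact_mod_cast (Finset.card_le_card this).trans Finset.card_biUnion_le

open Classical in
/-- Independence of one coordinate from an event that does not depend on it. -/
lemma numOf_step_le {Z : V → Finset Y} {φ : Y → V} {p : ℝ}
    (hp : ∀ v w, (((Z v).filter fun z => φ z = w).card : ℝ) ≤ p * (Z v).card) (u y : V)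
    {E : (V → Y) → Prop} (hE : ∀ ω z, E ω → E (Function.update ω u z)) :
    numOf Z (fun ω => φ (ω u) = y ∧ E ω) ≤ p * numOf Z E := by
  rcases (Z u).eq_empty_or_nonempty with hZ | hZ
  · have : Fintype.piFinset Z = ∅ := by
      refine Finset.eq_empty_of_forall_notMem fun ω hω => ?_
      have := Fintype.mem_piFinset.1 hω u
      rw [hZ] at this
      exact absurd this (Finset.notMem_empty _)
    simp [numOf, this]
  -- Exchanging coordinate u of ω with a fresh sample z is injective; the event `E` survives and the
  -- old coordinate carries the condition.
  have hinj : (((Fintype.piFinset Z).filter fun ω => φ (ω u) = y ∧ E ω) ×ˢ Z u).card ≤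
      (((Fintype.piFinset Z).filter E) ×ˢ (Z u).filter fun z => φ z = y).card := by
    refine Finset.card_le_card_of_injOn
      (fun x => (Function.update x.1 u x.2, x.1 u)) ?_ ?_
    · rintro ⟨ω, z⟩ h
      simp only [Finset.coe_product, Finset.coe_filter, Fintype.mem_piFinset, Set.mem_prod,
        Set.mem_ofPred_eq, Finset.mem_coe] at h ⊢
      obtain ⟨⟨hω, hy, hEω⟩, hz⟩ := h
      refine ⟨⟨fun v => ?_, hE ω z hEω⟩, hω u, hy⟩
      rcases eq_or_ne v u with rfl | hv
      · rwa [Function.update_self]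
      · rw [Function.update_of_ne hv]
        exact hω v
    · rintro ⟨ω, z⟩ - ⟨ω', z'⟩ - h
      simp only [Prod.mk.injEq] at h
      obtain ⟨h1, h2⟩ := h
      have hz : z = z' := by
        have := congrFun h1 u
        rwa [Function.update_self, Function.update_self] at this
      refine Prod.ext (funext fun v => ?_) hz
      rcases eq_or_ne v u with rfl | hv
      · exact h2
      · have := congrFun h1 v
        rwa [Function.update_of_ne hv, Function.update_of_ne hv] at this
  rw [Finset.card_product, Finset.card_product] at hinj
  have hinj' : numOf Z (fun ω => φ (ω u) = y ∧ E ω) * (Z u).card ≤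
      numOf Z E * (((Z u).filter fun z => φ z = y).card : ℝ) := by
    simp only [numOf]
    rw [← Nat.cast_mul, ← Nat.cast_mul, Nat.cast_le]
    convert hinj
  have hpos : (0 : ℝ) < (Z u).card := by exact_mod_cast hZ.card_pos
  refine le_of_mul_le_mul_right (hinj'.trans ?_) hpos
  calc _ ≤ numOf Z E * (p * (Z u).card) :=
        mul_le_mul_of_nonneg_left (hp u y) (numOf_nonneg _ _)
    _ = _ := by ring

variable {Z : V → Finset Y} {φ : Y → V} {p ρ : ℝ} {B : V → V → Prop}

open Classical in
lemma numOf_first_step_le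
    (hp : ∀ v w, (((Z v).filter fun z => φ z = w).card : ℝ) ≤ p * (Z v).card) (u : V)
    {E : V → (V → Y) → Prop} (hE : ∀ y ω z, E y ω → E y (Function.update ω u z)) :
    numOf Z (fun ω => B u (φ (ω u)) ∧ E (φ (ω u)) ω) ≤
      ∑ y, if B u y then p * numOf Z (E y) else 0 := by
  refine (numOf_le_sum (Finset.univ.filter fun y => B u y)
    (fun y ω => φ (ω u) = y ∧ E y ω) ?_).trans ?_
  · rintro ω ⟨hB, hω⟩
    exact ⟨_, Finset.mem_filter.2 ⟨Finset.mem_univ _, hB⟩, rfl, hω⟩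
  · rw [Finset.sum_filter]
    refine Finset.sum_le_sum fun y _ => ?_
    split_ifs
    · exact numOf_step_le hp u y (hE y)
    · exact le_rfl

-- Fix the second vertex y of the path. At most ρ/p sources v may send an arc to y, each doing so
-- with probability at most p, so summing over v gains a factor ρ per step.
open Classical in
lemma sum_numOf_reach_le
    (hp : ∀ v w, (((Z v).filter fun z => φ z = w).card : ℝ) ≤ p * (Z v).card) (hp0 : 0 ≤ p)
    (hcol : ∀ w, p * ((Finset.univ.filter fun v => B v w).card : ℝ) ≤ ρ)
    (A : Finset V) (u : V) : ∀ b : ℕ,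
    ∑ v, numOf Z (fun ω => Reach (fun x => φ (ω x)) B b A v u) ≤
      ρ ^ b * (Fintype.piFinset Z).card := by
  intro b
  induction b with
  | zero =>
    rw [pow_zero, one_mul, Finset.sum_eq_single u]
    · exact numOf_le_card _ _
    · intro v _ hv
      simp [numOf, Reach, hv]
    · simp
  | succ b ih =>
    have hstep : ∀ v, numOf Z (fun ω => Reach (fun x => φ (ω x)) B (b + 1) A v u) ≤
        ∑ y, if B v y then p * numOf Z (fun ω => Reach (fun x => φ (ω x)) B b A y u) else 0 := by
      intro v
      refine (numOf_mono (E' := fun ω => B v (φ (ω v)) ∧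
        Reach (fun x => φ (ω x)) B b (insert v A) (φ (ω v)) u) fun ω h => h.2).trans ?_
      refine (numOf_first_step_le
        (E := fun y ω => Reach (fun x => φ (ω x)) B b (insert v A) y u) hp v
        fun y ω z h => reach_update h).trans ?_
      refine Finset.sum_le_sum fun y _ => ?_
      split_ifs
      · exact mul_le_mul_of_nonneg_left
          (numOf_mono fun ω h => h.mono (Finset.subset_insert _ _)) hp0
      · exact le_rfl
    have hρ : 0 ≤ ρ := le_trans (by positivity) (hcol u)
    calc _ ≤ ∑ v, ∑ y, (if B v y then
          p * numOf Z (fun ω => Reach (fun x => φ (ω x)) B b A y u) else 0) :=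
          Finset.sum_le_sum fun v _ => hstep v
      _ = ∑ y, (p * ((Finset.univ.filter fun v => B v y).card : ℝ)) *
          numOf Z (fun ω => Reach (fun x => φ (ω x)) B b A y u) := by
          rw [Finset.sum_comm]
          refine Finset.sum_congr rfl fun y _ => ?_
          rw [← Finset.sum_filter, Finset.sum_const, nsmul_eq_mul]
          ring
      _ ≤ ∑ y, ρ * numOf Z (fun ω => Reach (fun x => φ (ω x)) B b A y u) :=
          Finset.sum_le_sum fun y _ => mul_le_mul_of_nonneg_right (hcol y) (numOf_nonneg _ _)
      _ ≤ ρ * (ρ ^ b * (Fintype.piFinset Z).card) := by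
          rw [← Finset.mul_sum]
          exact mul_le_mul_of_nonneg_left ih hρ
      _ = _ := by ring

open Classical in
lemma numOf_meet_succ_le
    (hp : ∀ v w, (((Z v).filter fun z => φ z = w).card : ℝ) ≤ p * (Z v).card)
    (a b : ℕ) (A : Finset V) (u v : V) :
    numOf Z (fun ω => Meet (fun x => φ (ω x)) B b (a + 1) A u v) ≤ ∑ y, if B u y then
      p * numOf Z (fun ω => Meet (fun x => φ (ω x)) B b a (insert u A) y v) else 0 := by
  refine (numOf_mono (E' := fun ω => B u (φ (ω u)) ∧
    Meet (fun x => φ (ω x)) B b a (insert u A) (φ (ω u)) v) fun ω h => h.2).trans ?_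
  exact numOf_first_step_le
    (E := fun y ω => Meet (fun x => φ (ω x)) B b a (insert u A) y v) hp u
    fun y ω z h => meet_update h

-- The orbit of the fixed vertex u is exposed first, each step costing ρ by the row bound; the
-- orbits that run into its end are then counted by the column bound.
open Classical in
lemma sum_numOf_meet_le
    (hp : ∀ v w, (((Z v).filter fun z => φ z = w).card : ℝ) ≤ p * (Z v).card) (hp0 : 0 ≤ p)
    (hcol : ∀ w, p * ((Finset.univ.filter fun v => B v w).card : ℝ) ≤ ρ)
    (hrow : ∀ v, p * ((Finset.univ.filter fun w => B v w).card : ℝ) ≤ ρ) (b : ℕ) :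
    ∀ (a : ℕ) (A : Finset V) (u : V),
    ∑ v, numOf Z (fun ω => Meet (fun x => φ (ω x)) B b a A u v) ≤
      ρ ^ (a + b) * (Fintype.piFinset Z).card := by
  intro a
  induction a with
  | zero =>
    intro A u
    rw [zero_add]
    exact sum_numOf_reach_le hp hp0 hcol A u b
  | succ a ih =>
    intro A u
    have hρ : 0 ≤ ρ := le_trans (by positivity) (hcol u)
    calc _ ≤ ∑ v, ∑ y, (if B u y then
          p * numOf Z (fun ω => Meet (fun x => φ (ω x)) B b a (insert u A) y v) else 0) :=
          Finset.sum_le_sum fun v _ => numOf_meet_succ_le hp a b A u v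
      _ = ∑ y ∈ Finset.univ.filter (fun y => B u y), p *
          ∑ v, numOf Z (fun ω => Meet (fun x => φ (ω x)) B b a (insert u A) y v) := by
          rw [Finset.sum_comm, Finset.sum_filter]
          refine Finset.sum_congr rfl fun y _ => ?_
          split_ifs
          · rw [Finset.mul_sum]
          · simp
      _ ≤ ∑ y ∈ Finset.univ.filter (fun y => B u y),
          p * (ρ ^ (a + b) * (Fintype.piFinset Z).card) :=
          Finset.sum_le_sum fun y _ => mul_le_mul_of_nonneg_left (ih _ _) hp0
      _ = (p * ((Finset.univ.filter fun y => B u y).card : ℝ)) *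
          (ρ ^ (a + b) * (Fintype.piFinset Z).card) := by
          rw [Finset.sum_const, nsmul_eq_mul]
          ring
      _ ≤ ρ * (ρ ^ (a + b) * (Fintype.piFinset Z).card) :=
          mul_le_mul_of_nonneg_right (hrow u) (by positivity)
      _ = _ := by ring

open Classical in
lemma sum_sum_numOf_meet_le
    (hp : ∀ v w, (((Z v).filter fun z => φ z = w).card : ℝ) ≤ p * (Z v).card) (hp0 : 0 ≤ p)
    (hρ : 0 ≤ ρ) (hcol : ∀ w, p * ((Finset.univ.filter fun v => B v w).card : ℝ) ≤ ρ) (b : ℕ)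
    (A : Finset V) : ∀ a : ℕ,
    ∑ u, ∑ v, numOf Z (fun ω => Meet (fun x => φ (ω x)) B b a A u v) ≤
      Fintype.card V * (ρ ^ (a + b) * (Fintype.piFinset Z).card) := by
  intro a
  induction a with
  | zero =>
    rw [zero_add, ← nsmul_eq_mul, ← Finset.card_univ, ← Finset.sum_const]
    exact Finset.sum_le_sum fun u _ => sum_numOf_reach_le hp hp0 hcol A u b
  | succ a ih =>
    calc _ ≤ ∑ u, ∑ v, ∑ y, (if B u y then
          p * numOf Z (fun ω => Meet (fun x => φ (ω x)) B b a A y v) else 0) := by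
          refine Finset.sum_le_sum fun u _ => Finset.sum_le_sum fun v _ =>
            (numOf_meet_succ_le hp a b A u v).trans (Finset.sum_le_sum fun y _ => ?_)
          split_ifs
          · exact mul_le_mul_of_nonneg_left
              (numOf_mono fun ω h => h.mono (Finset.subset_insert _ _)) hp0
          · exact le_rfl
      _ = ∑ y, (p * ((Finset.univ.filter fun u => B u y).card : ℝ)) *
          ∑ v, numOf Z (fun ω => Meet (fun x => φ (ω x)) B b a A y v) := by
          rw [Finset.sum_congr rfl fun u _ => Finset.sum_comm, Finset.sum_comm]
          refine Finset.sum_congr rfl fun y _ => ?_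
          rw [Finset.sum_comm, Finset.mul_sum]
          refine Finset.sum_congr rfl fun v _ => ?_
          rw [← Finset.sum_filter, Finset.sum_const, nsmul_eq_mul]
          ring
      _ ≤ ∑ y, ρ * ∑ v, numOf Z (fun ω => Meet (fun x => φ (ω x)) B b a A y v) :=
          Finset.sum_le_sum fun y _ => mul_le_mul_of_nonneg_right (hcol y)
            (Finset.sum_nonneg fun _ _ => numOf_nonneg _ _)
      _ ≤ ρ * (Fintype.card V * (ρ ^ (a + b) * (Fintype.piFinset Z).card)) := by
          rw [← Finset.mul_sum]
          exact mul_le_mul_of_nonneg_left ih hρ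
      _ = _ := by ring

lemma numOf_reachable_le (u v : V) :
    numOf Z (fun ω => (funGraph (fun x => φ (ω x)) B).Reachable u v) ≤
      ∑ a ∈ Finset.range (Fintype.card V + 1), ∑ b ∈ Finset.range (Fintype.card V + 1),
        numOf Z (fun ω => Meet (fun x => φ (ω x)) B b a ∅ u v) := by
  refine le_trans (numOf_le_sum
    (Finset.range (Fintype.card V + 1) ×ˢ Finset.range (Fintype.card V + 1))
    (fun i ω => Meet (fun x => φ (ω x)) B i.2 i.1 ∅ u v) fun ω h => ?_)
    (Finset.sum_product _ _ _).le
  obtain ⟨a, b, hab⟩ := exists_meet_of_reachable h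
  have := hab.card_le
  refine ⟨(a, b), ?_, hab⟩
  rw [Finset.mem_product, Finset.mem_range, Finset.mem_range]
  constructor <;> simp only <;> omega

lemma sum_geometric_le (hρ : 0 ≤ ρ) (hρ1 : ρ < 1) (m : ℕ) {c : ℝ} (hc : 0 ≤ c) :
    ∑ a ∈ Finset.range m, ∑ b ∈ Finset.range m, ρ ^ (a + b) * c ≤ c / (1 - ρ) ^ 2 := by
  have h1 : ∑ a ∈ Finset.range m, ρ ^ a ≤ 1 / (1 - ρ) := by
    have := geom_sum_Ico_le_of_lt_one (m := 0) (n := m) hρ hρ1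
    rwa [pow_zero, ← Finset.range_eq_Ico] at this
  have h0 : 0 ≤ ∑ a ∈ Finset.range m, ρ ^ a := Finset.sum_nonneg fun _ _ => pow_nonneg hρ _
  have : ∑ a ∈ Finset.range m, ∑ b ∈ Finset.range m, ρ ^ (a + b) * c =
      (∑ a ∈ Finset.range m, ρ ^ a) * (∑ a ∈ Finset.range m, ρ ^ a) * c := by
    rw [Finset.sum_mul_sum, Finset.sum_mul]
    refine Finset.sum_congr rfl fun a _ => ?_
    rw [Finset.sum_mul]
    exact Finset.sum_congr rfl fun b _ => by rw [pow_add]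
  rw [this]
  calc _ ≤ (1 / (1 - ρ)) * (1 / (1 - ρ)) * c := by gcongr
    _ = _ := by rw [sq, div_mul_div_comm, one_mul, one_div, div_eq_inv_mul]

open Classical in
/-- The expected number of vertices in the component of a vertex. -/
lemma sum_numOf_reachable_le
    (hp : ∀ v w, (((Z v).filter fun z => φ z = w).card : ℝ) ≤ p * (Z v).card) (hp0 : 0 ≤ p)
    (hρ1 : ρ < 1)
    (hcol : ∀ w, p * ((Finset.univ.filter fun v => B v w).card : ℝ) ≤ ρ)
    (hrow : ∀ v, p * ((Finset.univ.filter fun w => B v w).card : ℝ) ≤ ρ) (u : V) :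
    ∑ v, numOf Z (fun ω => (funGraph (fun x => φ (ω x)) B).Reachable u v) ≤
      (Fintype.piFinset Z).card / (1 - ρ) ^ 2 := by
  have hρ : 0 ≤ ρ := le_trans (by positivity) (hcol u)
  refine le_trans ?_ (sum_geometric_le hρ hρ1 (Fintype.card V + 1) (Nat.cast_nonneg _))
  refine (Finset.sum_le_sum fun v _ => numOf_reachable_le u v).trans ?_
  rw [Finset.sum_comm]
  refine Finset.sum_le_sum fun a _ => ?_
  rw [Finset.sum_comm]
  exact Finset.sum_le_sum fun b _ => sum_numOf_meet_le hp hp0 hcol hrow b a ∅ u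

open Classical in
/-- The expected number of connected pairs of vertices. -/
lemma sum_sum_numOf_reachable_le
    (hp : ∀ v w, (((Z v).filter fun z => φ z = w).card : ℝ) ≤ p * (Z v).card) (hp0 : 0 ≤ p)
    (hρ : 0 ≤ ρ) (hρ1 : ρ < 1)
    (hcol : ∀ w, p * ((Finset.univ.filter fun v => B v w).card : ℝ) ≤ ρ) :
    ∑ u, ∑ v, numOf Z (fun ω => (funGraph (fun x => φ (ω x)) B).Reachable u v) ≤
      Fintype.card V * ((Fintype.piFinset Z).card / (1 - ρ) ^ 2) := by
  have h := sum_geometric_le hρ hρ1 (Fintype.card V + 1)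
    (by positivity : (0 : ℝ) ≤ Fintype.card V * (Fintype.piFinset Z).card)
  rw [mul_div_assoc] at h
  refine le_trans ?_ h
  refine (Finset.sum_le_sum fun u _ => Finset.sum_le_sum fun v _ =>
    numOf_reachable_le u v).trans ?_
  rw [sum_comm_four]
  refine Finset.sum_le_sum fun a _ => Finset.sum_le_sum fun b _ => ?_
  refine (sum_sum_numOf_meet_le hp hp0 hρ hcol b ∅ a).trans (le_of_eq ?_)
  ring

end Exploration

/-! ### Balanced coarsening of a partition -/

section Coarsening

variable {V ι : Type*} [DecidableEq V] [DecidableEq ι]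

/-- A partition into parts of size at most `m` can be coarsened to one whose parts have size
between `m` and `3 * m`. -/
lemma exists_balanced_coarsening (κ : V → ι) {m : ℕ} (hm : 0 < m) : ∀ (N : ℕ) (U : Finset V),
    U.card ≤ N → m ≤ U.card → (∀ v w, κ v = κ w → v ∈ U → w ∈ U) →
    (∀ v ∈ U, (U.filter fun w => κ w = κ v).card ≤ m) →
    ∃ π : ι → ℕ, ∀ v ∈ U, m ≤ (U.filter fun w => π (κ w) = π (κ v)).card ∧
      (U.filter fun w => π (κ w) = π (κ v)).card ≤ 3 * m := by
  classical
  intro N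
  induction N with
  | zero => intro U hU hmU; omega
  | succ N ih =>
    intro U hU hmU hsat hκ
    by_cases hU3 : U.card ≤ 3 * m
    · refine ⟨fun _ => 0, fun v _ => ?_⟩
      simp only [Finset.filter_true]
      exact ⟨hmU, hU3⟩
    -- `T` is a smallest union of classes with at least m elements. Removing one class, of at most m
    -- elements, leaves fewer than m, so `T` has fewer than 2m and the rest of `U` more than m.
    obtain ⟨T, hT, hmin⟩ := Finset.exists_min_image
      (U.powerset.filter fun T => (∀ v w, κ v = κ w → v ∈ T → w ∈ T) ∧ m ≤ T.card) Finset.card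
      ⟨U, by simp only [Finset.mem_filter, Finset.mem_powerset]; exact ⟨subset_rfl, hsat, hmU⟩⟩
    simp only [Finset.mem_filter, Finset.mem_powerset] at hT hmin
    obtain ⟨hTU, hTsat, hmT⟩ := hT
    have hT2 : T.card < 2 * m := by
      obtain ⟨v, hv⟩ := Finset.card_pos.1 (hm.trans_le hmT)
      have hsplit := Finset.card_filter_add_card_filter_not (s := T) (fun w => κ w = κ v)
      have h1 : (T.filter fun w => κ w = κ v).card ≤ m :=
        (Finset.card_le_card (Finset.filter_subset_filter _ hTU)).trans (hκ v (hTU hv))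
      have h1' : 0 < (T.filter fun w => κ w = κ v).card :=
        Finset.card_pos.2 ⟨v, Finset.mem_filter.2 ⟨hv, rfl⟩⟩
      have h2 : (T.filter fun w => ¬ κ w = κ v).card < m := by
        by_contra! h
        have := hmin (T.filter fun w => ¬ κ w = κ v) ⟨(Finset.filter_subset _ _).trans hTU,
          fun a b hab ha => by
            rw [Finset.mem_filter] at ha ⊢
            exact ⟨hTsat a b hab ha.1, hab ▸ ha.2⟩, h⟩
        omega
      omega
    have hcard := Finset.card_sdiff_add_card_eq_card hTU
    obtain ⟨π, hπ⟩ := ih (U \ T) (by omega) (by omega)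
      (fun v w hvw hv => by
        rw [Finset.mem_sdiff] at hv ⊢
        exact ⟨hsat v w hvw hv.1, fun hw => hv.2 (hTsat w v hvw.symm hw)⟩)
      (fun v hv => (Finset.card_le_card (Finset.filter_subset_filter _ Finset.sdiff_subset)).trans
        (hκ v (Finset.mem_sdiff.1 hv).1))
    let π' : ι → ℕ := fun i => if i ∈ T.image κ then 0 else π i + 1
    have hmem : ∀ w, κ w ∈ T.image κ ↔ w ∈ T := by
      intro w
      rw [Finset.mem_image]
      exact ⟨fun ⟨a, ha, h⟩ => hTsat a w h ha, fun h => ⟨w, h, rfl⟩⟩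
    refine ⟨π', fun v hv => ?_⟩
    by_cases hvT : v ∈ T
    · have : (U.filter fun w => π' (κ w) = π' (κ v)) = T := by
        ext w
        simp only [Finset.mem_filter, π', hmem, if_pos hvT]
        constructor
        · rintro ⟨-, h⟩
          by_contra hw
          rw [if_neg hw] at h
          omega
        · exact fun hw => ⟨hTU hw, if_pos hw⟩
      rw [this]
      exact ⟨hmT, by omega⟩
    · have : (U.filter fun w => π' (κ w) = π' (κ v)) =
          (U \ T).filter fun w => π (κ w) = π (κ v) := by
        ext w
        simp only [Finset.mem_filter, Finset.mem_sdiff, π', hmem, if_neg hvT]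
        by_cases hw : w ∈ T
        · simp [hw]
        · simp [hw]
      rw [this]
      exact hπ v (Finset.mem_sdiff.2 ⟨hv, hvT⟩)

end Coarsening

/-! ### The colouring built from a partition -/

lemma ncard_supp_le_of_closed {V : Type*} [Finite V] {H : SimpleGraph V} {m : ℕ}
    (h : ∀ x, ∃ S : Finset V, x ∈ S ∧ (∀ a ∈ S, ∀ b, H.Adj a b → b ∈ S) ∧ S.card ≤ m)
    (K : H.ConnectedComponent) : K.supp.ncard ≤ m := by
  induction K using SimpleGraph.ConnectedComponent.ind with
  | _ x =>
    obtain ⟨S, hx, hcl, hS⟩ := h x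
    have hsub : (H.connectedComponentMk x).supp ⊆ (S : Set V) := by
      intro y hy
      rw [SimpleGraph.ConnectedComponent.mem_supp_iff, SimpleGraph.ConnectedComponent.eq] at hy
      obtain ⟨p⟩ := hy.symm
      clear hy
      induction p with
      | nil => exact hx
      | cons hadj p ih => exact ih (hcl _ hx _ hadj)
    exact (Set.ncard_le_ncard hsub S.finite_toSet).trans (by rwa [Set.ncard_coe_finset])

open Classical in
/-- The component of `u` in a graph on a finite vertex set, as a finset. -/
noncomputable def comp {V : Type*} [Fintype V] (G : SimpleGraph V) (u : V) : Finset V :=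
  Finset.univ.filter fun v => G.Reachable u v

lemma mem_comp {V : Type*} [Fintype V] {G : SimpleGraph V} {u v : V} :
    v ∈ comp G u ↔ G.Reachable u v := by
  simp [comp]

section Colouring

variable {n r : ℕ}

/-- The union of the components that meet `Y`. -/
noncomputable def compUnion {V : Type*} [Fintype V] [DecidableEq V] (G : SimpleGraph V) (Y : Finset V) :
    Finset V :=
  Y.biUnion (comp G)

/-- An ordered digraph admits a colouring with small monochromatic components when the arcs with
index `i₀`, apart from those leaving `X`, respect a partition `π` with small parts, and the
arcs with any other index that cross the partition have small components. -/
lemma exists_colouring_of_partition (D : OutDigraph n r) (ω : Fin n → Fin r → Fin n)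
    (hω : ∀ v w, w ∈ (D v).1 ↔ ∃ i, ω v i = w) {i₀ i₁ : Fin r} (h01 : i₁ ≠ i₀)
    (X : Finset (Fin n)) (π : Fin n → ℕ) (hπ : ∀ v ∉ X, π (ω v i₀) = π v) {m : ℕ}
    (hπm : ∀ v, (Finset.univ.filter fun w => π w = π v).card ≤ m)
    (hcomp : ∀ i, i ≠ i₀ → ∀ u,
      (comp (funGraph (fun v => ω v i) fun v w => π v ≠ π w) u).card ≤ m)
    (hX : (compUnion (funGraph (fun v => ω v i₁) fun v w => π v ≠ π w)
      (X ∪ X.image fun v => ω v i₀)).card ≤ m) :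
    ∃ c : EdgeColouring (outGraph D) r, ∀ (i : Fin r) (K : (colourClass c i).ConnectedComponent),
      K.supp.ncard ≤ m := by
  classical
  have hidx : ∀ e : E(outGraph D), ∃ i, ω e.1.1 i = e.1.2 := fun e => (hω _ _).1 e.2
  choose idx hidx using hidx
  -- Colour i₀ stays inside the parts, crossing arcs of another index keep that index as their
  -- colour, and the arcs of index i₀ leaving `X`, which may cross, are diverted to i₁.
  let c : EdgeColouring (outGraph D) r := fun e =>
    if idx e = i₀ then (if e.1.1 ∈ X then i₁ else i₀)
    else if π e.1.1 = π e.1.2 then i₀ else idx e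
  refine ⟨c, fun i => ncard_supp_le_of_closed fun x => ?_⟩
  by_cases hi : i = i₀
  · refine ⟨Finset.univ.filter fun w => π w = π x, by simp, ?_, hπm x⟩
    rintro a ha b ⟨-, e, hce, -, he⟩
    simp only [Finset.mem_filter, Finset.mem_univ, true_and] at ha ⊢
    rw [← ha]
    have hπe : π e.1.1 = π e.1.2 := by
      simp only [c] at hce
      split_ifs at hce with h1 h2 h3
      · exact absurd (hce.trans hi) h01
      · rw [← hidx e, h1, hπ _ h2]
      · exact h3
      · exact absurd (hce.trans hi) h1
    rcases he with he | he <;> rw [he] at hπe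
    · exact hπe.symm
    · exact hπe
  · set Y := X ∪ X.image fun v => ω v i₀ with hY
    set F := funGraph (fun v => ω v i) fun v w => π v ≠ π w with hF
    have hadj : ∀ a b, (colourClass c i).Adj a b → F.Adj a b ∨ (i = i₁ ∧ a ∈ Y ∧ b ∈ Y) := by
      rintro a b ⟨hab, e, hce, -, he⟩
      simp only [c] at hce
      split_ifs at hce with h1 h2 h3
      · right
        have hy1 : e.1.1 ∈ Y := Finset.mem_union_left _ h2
        have hy2 : e.1.2 ∈ Y := Finset.mem_union_right _
          (Finset.mem_image.2 ⟨_, h2, by rw [← h1]; exact hidx e⟩)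
        refine ⟨hce.symm, ?_⟩
        rcases he with he | he <;> rw [he] at hy1 hy2
        · exact ⟨hy1, hy2⟩
        · exact ⟨hy2, hy1⟩
      · exact absurd hce.symm hi
      · exact absurd hce.symm hi
      · left
        have hie := hidx e
        rw [hce] at hie
        refine ⟨hab, ?_⟩
        rcases he with he | he <;> rw [he] at hie h3
        · exact Or.inl ⟨by simpa only [hie] using h3, hie⟩
        · exact Or.inr ⟨by simpa only [hie] using h3, hie⟩
    -- The diverted arcs have both ends in `Y`, so they merge only components meeting `Y`; one
    -- closed set contains all of these.
    by_cases hx : i = i₁ ∧ x ∈ compUnion F Y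
    · refine ⟨compUnion F Y, hx.2, ?_, ?_⟩
      · intro a ha b hab
        rw [compUnion, Finset.mem_biUnion] at ha ⊢
        rcases hadj a b hab with h | ⟨-, -, h⟩
        · obtain ⟨u, hu, hua⟩ := ha
          exact ⟨u, hu, mem_comp.2 ((mem_comp.1 hua).trans h.reachable)⟩
        · exact ⟨b, h, mem_comp.2 (SimpleGraph.Reachable.refl _)⟩
      · rw [hF, hx.1]
        exact hX
    · refine ⟨comp F x, mem_comp.2 (SimpleGraph.Reachable.refl _), ?_, hcomp i hi x⟩
      intro a ha b hab
      rcases hadj a b hab with h | ⟨hi1, h, -⟩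
      · exact mem_comp.2 ((mem_comp.1 ha).trans h.reachable)
      · exact absurd ⟨hi1, Finset.mem_biUnion.2 ⟨a, h, mem_comp.2 (mem_comp.1 ha).symm⟩⟩ hx

end Colouring

lemma numOf_le_of_imp {V Y : Type*} [Fintype V] [DecidableEq V] {Z Z' : V → Finset Y}
    {E E' : (V → Y) → Prop}
    (h : ∀ ω ∈ Fintype.piFinset Z, E ω → ω ∈ Fintype.piFinset Z' ∧ E' ω) :
    numOf Z E ≤ numOf Z' E' := by
  classical
  refine Nat.cast_le.2 (Finset.card_le_card fun ω hω => ?_)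
  rw [Finset.mem_filter] at hω ⊢
  exact h ω hω.1 hω.2

/-! ### Ordered out-neighbourhoods -/

section OrderedDigraphs

/-- The orderings of the possible out-neighbourhoods of `v`. -/
def ordNbhds (n r : ℕ) (v : Fin n) : Finset (Fin r → Fin n) :=
  Finset.univ.filter fun y => Function.Injective y ∧ ∀ i, y i ≠ v

/-- The orderings of the out-neighbourhoods with prescribed entries of index `i₀`. -/
def ordNbhdsWith (n r : ℕ) (i₀ : Fin r) (g : Fin n → Fin n) (v : Fin n) :
    Finset (Fin r → Fin n) :=
  (ordNbhds n r v).filter fun y => y i₀ = g v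

variable {n r : ℕ}

lemma mem_ordNbhds {v : Fin n} {y : Fin r → Fin n} :
    y ∈ ordNbhds n r v ↔ Function.Injective y ∧ ∀ i, y i ≠ v := by
  simp [ordNbhds]

/-- By symmetry the fibres over the complement of `F` all have the same size, so each takes its
equal share of `Z`. -/
lemma card_fiber_mul_le {V Y : Type*} [Fintype V] [DecidableEq V] (Z : Finset Y) (φ : Y → V)
    (F : Finset V) (hF : ∀ z ∈ Z, φ z ∉ F)
    (hsymm : ∀ w ∉ F, ∀ w' ∉ F,
      (Z.filter fun z => φ z = w).card ≤ (Z.filter fun z => φ z = w').card) (w : V) :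
    (Z.filter fun z => φ z = w).card * (Fintype.card V - F.card) ≤ Z.card := by
  by_cases hw : w ∈ F
  · have : (Z.filter fun z => φ z = w) = ∅ :=
      Finset.filter_eq_empty_iff.2 fun z hz hzw => hF z hz (hzw ▸ hw)
    simp [this]
  rw [Finset.card_eq_sum_card_fiberwise (f := φ) (t := Fᶜ) (s := Z)
    (fun z hz => by simpa using hF z hz), ← Finset.card_compl, mul_comm, ← smul_eq_mul,
    ← Finset.sum_const]
  exact Finset.sum_le_sum fun w' hw' => hsymm w hw w' (by simpa using hw')

/-- Transposing w and w' maps one fibre into the other. The analogue with index i₀ prescribed needs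
both to differ from g v as well. -/
lemma card_ordNbhds_fiber_le (i : Fin r) {v w w' : Fin n} (hw : w ≠ v) (hw' : w' ≠ v) :
    ((ordNbhds n r v).filter fun z => z i = w).card ≤
      ((ordNbhds n r v).filter fun z => z i = w').card := by
  refine Finset.card_le_card_of_injOn (fun z => Equiv.swap w w' ∘ z) ?_ ?_
  · intro z hz
    simp only [Finset.coe_filter, mem_ordNbhds, Set.mem_ofPred_eq] at hz ⊢
    refine ⟨⟨(Equiv.swap w w').injective.comp hz.1.1, fun j hj => hz.1.2 j ?_⟩, ?_⟩
    · rw [Function.comp_apply, Equiv.swap_apply_eq_iff,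
        Equiv.swap_apply_of_ne_of_ne hw.symm hw'.symm] at hj
      exact hj
    · rw [Function.comp_apply, hz.2, Equiv.swap_apply_left]
  · intro z _ z' _ h
    exact (Equiv.swap w w').injective.comp_left h

lemma card_ordNbhdsWith_fiber_le {i₀ i : Fin r} {g : Fin n → Fin n} {v w w' : Fin n}
    (hw : w ≠ v) (hw' : w' ≠ v) (hwg : w ≠ g v) (hwg' : w' ≠ g v) :
    ((ordNbhdsWith n r i₀ g v).filter fun z => z i = w).card ≤
      ((ordNbhdsWith n r i₀ g v).filter fun z => z i = w').card := by
  refine Finset.card_le_card_of_injOn (fun z => Equiv.swap w w' ∘ z) ?_ ?_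
  · intro z hz
    simp only [ordNbhdsWith, Finset.coe_filter, Finset.mem_filter, mem_ordNbhds,
      Set.mem_ofPred_eq] at hz ⊢
    refine ⟨⟨⟨(Equiv.swap w w').injective.comp hz.1.1.1, fun j hj => hz.1.1.2 j ?_⟩, ?_⟩, ?_⟩
    · rw [Function.comp_apply, Equiv.swap_apply_eq_iff,
        Equiv.swap_apply_of_ne_of_ne hw.symm hw'.symm] at hj
      exact hj
    · rw [Function.comp_apply, hz.1.2, Equiv.swap_apply_of_ne_of_ne hwg.symm hwg'.symm]
    · rw [Function.comp_apply, hz.2, Equiv.swap_apply_left]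
  · intro z _ z' _ h
    exact (Equiv.swap w w').injective.comp_left h

lemma card_fiber_le_of_mul_le {a b f : ℕ} (hn : 3 ≤ n) (hf : f ≤ 2) (h : a * (n - f) ≤ b) :
    (a : ℝ) ≤ 1 / ((n : ℝ) - 2) * b := by
  have hn' : (3 : ℝ) ≤ n := by exact_mod_cast hn
  have h1 : a * (n - 2) ≤ b := (Nat.mul_le_mul_left _ (by omega)).trans h
  have h2 : (a : ℝ) * (n - 2) ≤ b := by
    have : ((n - 2 : ℕ) : ℝ) = n - 2 := by rw [Nat.cast_sub (by omega)]; simp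
    rw [← this]
    exact_mod_cast h1
  rw [one_div, ← div_eq_inv_mul, le_div_iff₀ (by linarith)]
  exact h2

lemma ordNbhds_fiber_le (hn : 3 ≤ n) (i : Fin r) (v w : Fin n) :
    (((ordNbhds n r v).filter fun z => z i = w).card : ℝ) ≤
      1 / ((n : ℝ) - 2) * (ordNbhds n r v).card := by
  refine card_fiber_le_of_mul_le hn (f := ({v} : Finset (Fin n)).card) (by simp) ?_
  have := card_fiber_mul_le (ordNbhds n r v) (fun z => z i) {v}
    (fun z hz => by simpa using (mem_ordNbhds.1 hz).2 i)
    (fun w hw w' hw' => card_ordNbhds_fiber_le i (by simpa using hw) (by simpa using hw')) w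
  rwa [Fintype.card_fin] at this

lemma ordNbhdsWith_fiber_le (hn : 3 ≤ n) {i₀ i : Fin r} (hi : i ≠ i₀) (g : Fin n → Fin n)
    (v w : Fin n) :
    (((ordNbhdsWith n r i₀ g v).filter fun z => z i = w).card : ℝ) ≤
      1 / ((n : ℝ) - 2) * (ordNbhdsWith n r i₀ g v).card := by
  refine card_fiber_le_of_mul_le hn (f := ({v, g v} : Finset (Fin n)).card)
    Finset.card_le_two ?_
  have := card_fiber_mul_le (ordNbhdsWith n r i₀ g v) (fun z => z i) {v, g v}
    (fun z hz => by
      rw [ordNbhdsWith, Finset.mem_filter, mem_ordNbhds] at hz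
      rw [Finset.mem_insert, Finset.mem_singleton, not_or]
      exact ⟨hz.1.2 i, fun h => hi (hz.1.1 (h.trans hz.2.symm))⟩)
    (fun w hw w' hw' => by
      rw [Finset.mem_insert, Finset.mem_singleton, not_or] at hw hw'
      exact card_ordNbhdsWith_fiber_le hw.1 hw'.1 hw.2 hw'.2) w
  rwa [Fintype.card_fin] at this

lemma card_orderings (S : Finset (Fin n)) (hS : S.card = r) :
    ((Finset.univ : Finset (Fin r → Fin n)).filter fun y =>
      Function.Injective y ∧ Finset.univ.image y = S).card = r.factorial := by
  classical
  have hcard : Fintype.card (Fin r) = Fintype.card S := by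
    rw [Fintype.card_fin, Fintype.card_coe, hS]
  have h1 : Fintype.card (Fin r ≃ S) = r.factorial := by
    rw [Fintype.card_equiv (Fintype.equivOfCardEq hcard), Fintype.card_fin]
  rw [← h1, ← Finset.card_univ]
  symm
  refine Finset.card_bij (fun e _ i => (e i : Fin n)) ?_ ?_ ?_
  · intro e _
    simp only [Finset.mem_filter, Finset.mem_univ, true_and]
    refine ⟨Subtype.val_injective.comp e.injective, ?_⟩
    ext w
    simp only [Finset.mem_image, Finset.mem_univ, true_and]
    exact ⟨fun ⟨i, hi⟩ => hi ▸ (e i).2, fun hw => ⟨e.symm ⟨w, hw⟩, by simp⟩⟩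
  · intro e _ e' _ h
    ext i
    exact congrArg Fin.val (congrFun h i)
  · intro y hy
    simp only [Finset.mem_filter, Finset.mem_univ, true_and] at hy
    have hmem : ∀ i, y i ∈ S := fun i => hy.2 ▸ Finset.mem_image_of_mem _ (Finset.mem_univ i)
    have hbij : Function.Bijective fun i => (⟨y i, hmem i⟩ : S) := by
      rw [Fintype.bijective_iff_injective_and_card]
      exact ⟨fun i j h => hy.1 (congrArg Subtype.val h), hcard⟩
    exact ⟨Equiv.ofBijective _ hbij, Finset.mem_univ _, rfl⟩

/-- The out-neighbourhoods of an ordered digraph. -/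
def unorder (ω : Fin n → Fin r → Fin n) (v : Fin n) : Finset (Fin n) := Finset.univ.image (ω v)

lemma unorder_mem {ω : Fin n → Fin r → Fin n} (hω : ω ∈ Fintype.piFinset (ordNbhds n r)) :
    unorder ω ∈ outSets n r := by
  rw [mem_outSets]
  intro v
  have h := mem_ordNbhds.1 (Fintype.mem_piFinset.1 hω v)
  refine ⟨fun hv => ?_, ?_⟩
  · obtain ⟨i, -, hi⟩ := Finset.mem_image.1 hv
    exact h.2 i hi
  · rw [unorder, Finset.card_image_of_injective _ h.1, Finset.card_univ, Fintype.card_fin]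

/-- Every digraph has the same number of orderings, so a uniform ordered digraph induces a uniform
digraph. -/
lemma card_unorder_fiber {S : Fin n → Finset (Fin n)} (hS : S ∈ outSets n r) :
    ((Fintype.piFinset (ordNbhds n r)).filter fun ω => unorder ω = S).card =
      r.factorial ^ n := by
  have hS' := mem_outSets.1 hS
  have : ((Fintype.piFinset (ordNbhds n r)).filter fun ω => unorder ω = S) =
      Fintype.piFinset fun v => (Finset.univ : Finset (Fin r → Fin n)).filter fun y =>
        Function.Injective y ∧ Finset.univ.image y = S v := by
    ext ω
    simp only [Finset.mem_filter, Fintype.mem_piFinset, mem_ordNbhds, Finset.mem_univ, true_and]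
    constructor
    · rintro ⟨h1, h2⟩ v
      exact ⟨(h1 v).1, congrFun h2 v⟩
    · intro h
      refine ⟨fun v => ⟨(h v).1, fun i hi => (hS' v).1 ?_⟩, funext fun v => (h v).2⟩
      rw [← (h v).2]
      exact Finset.mem_image.2 ⟨i, Finset.mem_univ _, hi⟩
  rw [this, Fintype.card_piFinset, Finset.prod_congr rfl fun v _ => card_orderings (S v) (hS' v).2,
    Finset.prod_const, Finset.card_univ, Fintype.card_fin]

lemma card_piFinset_ordNbhds :
    (Fintype.piFinset (ordNbhds n r)).card = r.factorial ^ n * (outSets n r).card := by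
  classical
  rw [Finset.card_eq_sum_card_fiberwise (f := unorder) (t := outSets n r)
    (fun ω hω => unorder_mem hω), Finset.sum_congr rfl fun S hS => card_unorder_fiber hS,
    Finset.sum_const, smul_eq_mul, mul_comm]

/-- A family of digraphs whose orderings are all exceptional is rare if the exceptional
ordered digraphs are rare. -/
lemma card_le_of_numOf_le {θ : ℝ} {E : (Fin n → Fin r → Fin n) → Prop}
    (hE : numOf (ordNbhds n r) E ≤ θ * (Fintype.piFinset (ordNbhds n r)).card)
    {bad : Finset (Fin n → Finset (Fin n))} (hbad : bad ⊆ outSets n r)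
    (h : ∀ ω ∈ Fintype.piFinset (ordNbhds n r), unorder ω ∈ bad → E ω) :
    (bad.card : ℝ) ≤ θ * (outSets n r).card := by
  classical
  have hpos : (0 : ℝ) < (r.factorial : ℝ) ^ n := by positivity
  have h1 : bad.card * r.factorial ^ n ≤
      ((Fintype.piFinset (ordNbhds n r)).filter fun ω => unorder ω ∈ bad).card := by
    rw [Finset.card_eq_sum_card_fiberwise (f := unorder) (t := bad)
      (s := (Fintype.piFinset (ordNbhds n r)).filter fun ω => unorder ω ∈ bad)
      (fun ω hω => (Finset.mem_filter.1 (Finset.mem_coe.1 hω)).2), ← smul_eq_mul, ← Finset.sum_const]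
    refine Finset.sum_le_sum fun S hS => ?_
    rw [← card_unorder_fiber (hbad hS)]
    refine Finset.card_le_card fun ω hω => ?_
    rw [Finset.mem_filter] at hω
    exact Finset.mem_filter.2 ⟨Finset.mem_filter.2 ⟨hω.1, hω.2.symm ▸ hS⟩, hω.2⟩
  have h2 : ((((Fintype.piFinset (ordNbhds n r)).filter
      fun ω => unorder ω ∈ bad).card : ℕ) : ℝ) ≤ numOf (ordNbhds n r) E := by
    refine Nat.cast_le.2 (Finset.card_le_card fun ω hω => ?_)
    rw [Finset.mem_filter] at hω ⊢
    exact ⟨hω.1, h ω hω.1 hω.2⟩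
  have h1' : (bad.card : ℝ) * (r.factorial : ℝ) ^ n ≤ numOf (ordNbhds n r) E :=
    le_trans (by exact_mod_cast h1) h2
  rw [card_piFinset_ordNbhds] at hE
  push_cast at hE
  refine le_of_mul_le_mul_right (h1'.trans (hE.trans (le_of_eq ?_))) hpos
  ring

/-- Total probability over the arcs of index `i₀`. -/
lemma numOf_le_of_conditional (i₀ : Fin r) {θ : ℝ}
    (E : (Fin n → Fin n) → (Fin n → Fin r → Fin n) → Prop)
    (hE : ∀ g, numOf (ordNbhdsWith n r i₀ g) (E g) ≤
      θ * (Fintype.piFinset (ordNbhdsWith n r i₀ g)).card) :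
    numOf (ordNbhds n r) (fun ω => E (fun v => ω v i₀) ω) ≤
      θ * (Fintype.piFinset (ordNbhds n r)).card := by
  classical
  have hpi : ∀ g, Fintype.piFinset (ordNbhdsWith n r i₀ g) =
      (Fintype.piFinset (ordNbhds n r)).filter fun ω => (fun v => ω v i₀) = g := by
    intro g
    ext ω
    simp only [ordNbhdsWith, Finset.mem_filter, Fintype.mem_piFinset, forall_and, funext_iff]
  have h1 : numOf (ordNbhds n r) (fun ω => E (fun v => ω v i₀) ω) ≤
      ∑ g : Fin n → Fin n, numOf (ordNbhdsWith n r i₀ g) (E g) := by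
    refine (numOf_le_sum Finset.univ
      (fun g (ω : Fin n → Fin r → Fin n) => (fun v => ω v i₀) = g ∧ E g ω)
      fun ω h => ⟨_, Finset.mem_univ _, rfl, h⟩).trans (Finset.sum_le_sum fun g _ => ?_)
    refine numOf_le_of_imp fun ω hω h => ⟨?_, h.2⟩
    rw [hpi, Finset.mem_filter]
    exact ⟨hω, h.1⟩
  refine h1.trans ((Finset.sum_le_sum fun g _ => hE g).trans (le_of_eq ?_))
  rw [← Finset.mul_sum, Finset.card_eq_sum_card_fiberwise (f := fun (ω : Fin n → Fin r → Fin n) v => ω v i₀)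
    (t := Finset.univ) (fun _ _ => Finset.mem_coe.2 (Finset.mem_univ _))]
  push_cast
  congr 1
  exact Finset.sum_congr rfl fun g _ => by rw [hpi]

end OrderedDigraphs

/-! ### Markov bounds for large components -/

section Markov

variable {V Y : Type*} [Fintype V] [DecidableEq V] {Z : V → Finset Y}

lemma numOf_mul_le_sum_of_imp {E : (V → Y) → Prop} {f : (V → Y) → ℕ} {c : ℕ}
    (h : ∀ ω, E ω → c ≤ f ω) :
    numOf Z E * c ≤ ((∑ ω ∈ Fintype.piFinset Z, f ω : ℕ) : ℝ) := by
  classical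
  rw [numOf, ← Nat.cast_mul, Nat.cast_le, ← smul_eq_mul, ← Finset.sum_const]
  exact (Finset.sum_le_sum fun ω hω => h ω (Finset.mem_filter.1 hω).2).trans
    (Finset.sum_le_sum_of_subset (Finset.filter_subset _ _))

lemma numOf_mul_le_sum {ι : Type*} (s : Finset ι) (F : ι → (V → Y) → Prop)
    [∀ ω, DecidablePred fun i => F i ω] (c : ℕ) :
    numOf Z (fun ω => c ≤ (s.filter fun i => F i ω).card) * c ≤ ∑ i ∈ s, numOf Z (F i) := by
  classical
  have h : ∑ i ∈ s, numOf Z (F i) =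
      ((∑ ω ∈ Fintype.piFinset Z, (s.filter fun i => F i ω).card : ℕ) : ℝ) := by
    simp only [numOf]
    rw [← Nat.cast_sum]
    congr 1
    simp only [Finset.card_filter]
    rw [Finset.sum_comm]
    exact Finset.sum_congr rfl fun ω _ => Finset.sum_congr rfl fun i _ => by congr
  rw [h]
  exact numOf_mul_le_sum_of_imp fun ω hω => hω

variable {φ : Y → V} {p ρ : ℝ} {B : V → V → Prop}

-- A component with m vertices contributes m² ordered connected pairs; Markov's inequality is
-- applied to the number of such pairs.
open Classical in
lemma numOf_large_comp_mul_le
    (hp : ∀ v w, (((Z v).filter fun z => φ z = w).card : ℝ) ≤ p * (Z v).card) (hp0 : 0 ≤ p)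
    (hρ : 0 ≤ ρ) (hρ1 : ρ < 1)
    (hcol : ∀ w, p * ((Finset.univ.filter fun v => B v w).card : ℝ) ≤ ρ) (m : ℕ) :
    numOf Z (fun ω => ∃ u, m ≤ (comp (funGraph (fun x => φ (ω x)) B) u).card) * (m * m) ≤
      Fintype.card V * ((Fintype.piFinset Z).card / (1 - ρ) ^ 2) := by
  refine le_trans ?_ (sum_sum_numOf_reachable_le hp hp0 hρ hρ1 hcol)
  rw [← Finset.sum_product']
  have h := numOf_mul_le_sum (Z := Z) (Finset.univ ×ˢ Finset.univ : Finset (V × V))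
    (fun x ω => (funGraph (fun x => φ (ω x)) B).Reachable x.1 x.2) (m * m)
  push_cast at h
  refine le_trans (mul_le_mul_of_nonneg_right (numOf_mono fun ω ⟨u, hu⟩ => ?_)
    (by positivity)) h
  refine (Nat.mul_le_mul hu hu).trans ?_
  rw [← Finset.card_product]
  refine Finset.card_le_card fun x hx => ?_
  rw [Finset.mem_product, mem_comp, mem_comp] at hx
  exact Finset.mem_filter.2 ⟨by simp, hx.1.symm.trans hx.2⟩

-- Markov's inequality for the pairs with first vertex in `X`. The bound is linear in the size of
-- `X`, so a small `X` reaches few vertices.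
open Classical in
lemma numOf_large_compUnion_mul_le
    (hp : ∀ v w, (((Z v).filter fun z => φ z = w).card : ℝ) ≤ p * (Z v).card) (hp0 : 0 ≤ p)
    (hρ1 : ρ < 1)
    (hcol : ∀ w, p * ((Finset.univ.filter fun v => B v w).card : ℝ) ≤ ρ)
    (hrow : ∀ v, p * ((Finset.univ.filter fun w => B v w).card : ℝ) ≤ ρ) (X : Finset V) (m : ℕ) :
    numOf Z (fun ω => m ≤ (compUnion (funGraph (fun x => φ (ω x)) B) X).card) * m ≤
      X.card * ((Fintype.piFinset Z).card / (1 - ρ) ^ 2) := by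
  have h1 : ∑ u ∈ X, ∑ v, numOf Z (fun ω => (funGraph (fun x => φ (ω x)) B).Reachable u v) ≤
      X.card * ((Fintype.piFinset Z).card / (1 - ρ) ^ 2) := by
    rw [← nsmul_eq_mul, ← Finset.sum_const]
    exact Finset.sum_le_sum fun u _ => sum_numOf_reachable_le hp hp0 hρ1 hcol hrow u
  refine le_trans ?_ h1
  rw [← Finset.sum_product']
  have h := numOf_mul_le_sum (Z := Z) (X ×ˢ Finset.univ : Finset (V × V))
    (fun x ω => (funGraph (fun x => φ (ω x)) B).Reachable x.1 x.2) m
  refine le_trans (mul_le_mul_of_nonneg_right (numOf_mono fun ω hω => ?_)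
    (by positivity)) h
  refine hω.trans ?_
  refine (Finset.card_le_card (t := ((X ×ˢ Finset.univ : Finset (V × V)).filter fun x =>
    (funGraph (fun x => φ (ω x)) B).Reachable x.1 x.2).image Prod.snd) fun v hv => ?_).trans
    Finset.card_image_le
  obtain ⟨u, hu, huv⟩ := Finset.mem_biUnion.1 hv
  exact Finset.mem_image.2 ⟨(u, v), Finset.mem_filter.2 ⟨by simp [hu], mem_comp.1 huv⟩, rfl⟩

end Markov

/-! ### Parameter estimates and exceptional ordered digraphs -/

/-- Since j ≤ (1 - c)n, half of the gain c absorbs the loss from dividing by n - 2 instead of n;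
this is where c * n ≥ 4 enters. -/
lemma complement_ratio_le {n k j : ℕ} {c : ℝ} (hjk : j + k ≤ n) (hk : c * n ≤ k)
    (hc : 4 ≤ c * n) (hn : 3 ≤ n) : 1 / ((n : ℝ) - 2) * j ≤ 1 - c / 2 := by
  have hn' : (3 : ℝ) ≤ n := by exact_mod_cast hn
  have hjk' : (j : ℝ) + k ≤ n := by exact_mod_cast hjk
  have hc0 : 0 ≤ c := by
    by_contra! h
    nlinarith
  rw [one_div, ← div_eq_inv_mul, div_le_iff₀ (by linarith)]
  linarith

lemma div_one_sub_one_sub_half_sq (T c : ℝ) : T / (1 - (1 - c / 2)) ^ 2 = 4 * T / c ^ 2 := by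
  rw [sub_sub_cancel, div_pow, div_div_eq_mul_div]
  ring

lemma pair_bound_le {η θ r T n m : ℝ} (hη : 0 < η) (hr : 0 < r) (hT : 0 ≤ T)
    (hn : 0 < n) (hm : η * n ≤ m) (hnr : 32 * r ≤ θ * η ^ 4 * n) :
    n * (4 * T / η ^ 2) ≤ θ / (8 * r) * T * (m * m) := by
  have hθ : 0 ≤ θ := by
    by_contra! h
    have : θ * (η ^ 4 * n) < 0 := mul_neg_of_neg_of_pos h (by positivity)
    linarith
  have hm0 : 0 ≤ m := le_trans (by positivity) hm
  have hmm : (η * n) * (η * n) ≤ m * m := by gcongr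
  calc n * (4 * T / η ^ 2) = (32 * r) * (T * n / (8 * r * η ^ 2)) := by
        field_simp
        ring
    _ ≤ (θ * η ^ 4 * n) * (T * n / (8 * r * η ^ 2)) := by gcongr
    _ = θ / (8 * r) * T * ((η * n) * (η * n)) := by field_simp
    _ ≤ _ := by gcongr

lemma point_bound_le {η θ T n m x y : ℝ} (hη : 0 < η) (hθ : 0 < θ) (hT : 0 ≤ T)
    (hm : η * n ≤ m) (hy : y ≤ 2 * x) (hx : 32 * x ≤ θ * η ^ 3 * n) :
    y * (4 * T / η ^ 2) ≤ θ / 4 * T * m := by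
  calc y * (4 * T / η ^ 2) ≤ 2 * x * (4 * T / η ^ 2) := by gcongr
    _ = (32 * x) * (T / (4 * η ^ 2)) := by
        field_simp
        ring
    _ ≤ (θ * η ^ 3 * n) * (T / (4 * η ^ 2)) := by gcongr
    _ = θ / 4 * T * (η * n) := by field_simp
    _ ≤ _ := by gcongr

lemma core_bound_le {η δ θ T n m : ℝ} (hη : 0 < η) (hδ : 0 < δ) (hT : 0 ≤ T)
    (hn : 0 < n) (hm : η * n ≤ m) (hnθ : 8 ≤ θ * δ ^ 2 * η ^ 2 * n) :
    n * (4 * T / δ ^ 2) ≤ θ / 2 * T * (m * m) := by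
  have hθ : 0 ≤ θ := by
    by_contra! h
    have : θ * (δ ^ 2 * η ^ 2 * n) < 0 := mul_neg_of_neg_of_pos h (by positivity)
    linarith
  have hm0 : 0 ≤ m := le_trans (by positivity) hm
  have hmm : (η * n) * (η * n) ≤ m * m := by gcongr
  calc n * (4 * T / δ ^ 2) = 8 * (T * n / (2 * δ ^ 2)) := by
        field_simp
        ring
    _ ≤ (θ * δ ^ 2 * η ^ 2 * n) * (T * n / (2 * δ ^ 2)) := by gcongr
    _ = θ / 2 * T * ((η * n) * (η * n)) := by field_simp
    _ ≤ _ := by gcongr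

/-- The parts are unions of components, so no arc leaving a vertex outside `X` crosses between them.
-/
lemma exists_balanced_partition {n m : ℕ} (hm : 0 < m) (hmn : m ≤ n) (X : Finset (Fin n))
    (g : Fin n → Fin n)
    (hg : ¬ ∃ u, m ≤ (comp (funGraph g fun v _ => v ∉ X) u).card) :
    ∃ π : Fin n → ℕ, (∀ v ∉ X, π (g v) = π v) ∧
      ∀ v, m ≤ (Finset.univ.filter fun w => π w = π v).card ∧
        (Finset.univ.filter fun w => π w = π v).card ≤ 3 * m := by
  classical
  push Not at hg
  set G := funGraph g fun v _ => v ∉ X with hG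
  obtain ⟨π, hπ⟩ := exists_balanced_coarsening G.connectedComponentMk hm n Finset.univ (by simp)
    (by simpa using hmn) (fun _ _ _ _ => Finset.mem_univ _) (fun v _ => by
      refine le_trans (Finset.card_le_card fun w hw => ?_) (hg v).le
      rw [Finset.mem_filter, SimpleGraph.ConnectedComponent.eq] at hw
      exact mem_comp.2 hw.2.symm)
  refine ⟨fun v => π (G.connectedComponentMk v), fun v hv => ?_, fun v => hπ v (Finset.mem_univ v)⟩
  by_cases hgv : g v = v
  · simp only [hgv]
  · have : G.Adj v (g v) := ⟨fun h => hgv h.symm, Or.inl ⟨hv, rfl⟩⟩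
    exact congrArg π (SimpleGraph.ConnectedComponent.sound this.symm.reachable)

-- The failure budget is θ/(8r) for each of at most r indices and θ/4 for the union of components
-- around `X`, in total at most 3θ/8.
open Classical in
lemma numOf_large_crossing_comp_le {n r : ℕ} {i₀ i₁ : Fin r} (h01 : i₁ ≠ i₀)
    {X : Finset (Fin n)} {m : ℕ} {B : Fin n → Fin n → Prop}
    {η θ : ℝ} (hη : 0 < η) (hθ : 0 < θ) (hn : 3 ≤ n) (hηn : 4 ≤ η * n) (hm : η * n ≤ m)
    (hX : 32 * (X.card : ℝ) ≤ θ * η ^ 3 * n) (hnr : 32 * r ≤ θ * η ^ 4 * n)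
    (g : Fin n → Fin n)
    (hcol : ∀ w, 1 / ((n : ℝ) - 2) * ((Finset.univ.filter fun v => B v w).card : ℝ) ≤ 1 - η / 2)
    (hrow : ∀ v, 1 / ((n : ℝ) - 2) * ((Finset.univ.filter fun w => B v w).card : ℝ) ≤ 1 - η / 2) :
    numOf (ordNbhdsWith n r i₀ g) (fun ω =>
      (∃ i, i ≠ i₀ ∧ ∃ u, m ≤ (comp (funGraph (fun v => ω v i) B) u).card) ∨
      m ≤ (compUnion (funGraph (fun v => ω v i₁) B) (X ∪ X.image g)).card) ≤
      (θ / 2) * (Fintype.piFinset (ordNbhdsWith n r i₀ g)).card := by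
  set T : ℝ := ((Fintype.piFinset (ordNbhdsWith n r i₀ g)).card : ℝ) with hT
  have hT0 : 0 ≤ T := Nat.cast_nonneg _
  have hn' : (3 : ℝ) ≤ n := by exact_mod_cast hn
  have hp0 : (0 : ℝ) ≤ 1 / ((n : ℝ) - 2) := by
    rw [one_div, inv_nonneg]
    linarith
  have hρ : (0 : ℝ) ≤ 1 - η / 2 := 
    (mul_nonneg hp0 (Nat.cast_nonneg _)).trans (hcol ⟨0, by omega⟩)
  have hρ1 : 1 - η / 2 < 1 := by linarith
  have hm0 : (0 : ℝ) < m := by linarith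
  have hT4 := div_one_sub_one_sub_half_sq T η
  have h1 : ∀ i, i ≠ i₀ → numOf (ordNbhdsWith n r i₀ g) (fun ω => ∃ u,
      m ≤ (comp (funGraph (fun v => ω v i) B) u).card) ≤
      θ / (8 * r) * T := by
    intro i hi
    have h := numOf_large_comp_mul_le (Z := ordNbhdsWith n r i₀ g) (φ := fun y => y i)
      (B := B) (fun v w => ordNbhdsWith_fiber_le hn hi g v w) hp0 hρ hρ1
      hcol m
    rw [← hT, hT4, Fintype.card_fin, ← le_div_iff₀ (by positivity)] at h
    refine h.trans ?_
    have hr : (0 : ℝ) < r := by exact_mod_cast i.pos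
    rw [div_le_iff₀ (by positivity)]
    exact pair_bound_le hη hr hT0 (by linarith) hm hnr
  have h2 : numOf (ordNbhdsWith n r i₀ g) (fun ω =>
      m ≤ (compUnion (funGraph (fun v => ω v i₁) B)
        (X ∪ X.image g)).card) ≤ θ / 4 * T := by
    have h := numOf_large_compUnion_mul_le (Z := ordNbhdsWith n r i₀ g) (φ := fun y => y i₁)
      (B := B) (fun v w => ordNbhdsWith_fiber_le hn h01 g v w) hp0 hρ1
      hcol hrow (X ∪ X.image g) m
    rw [← hT, hT4, ← le_div_iff₀ hm0] at h
    refine h.trans ?_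
    rw [div_le_iff₀ hm0]
    have hY : ((X ∪ X.image g).card : ℝ) ≤ 2 * X.card := by
      have := (Finset.card_union_le X (X.image g)).trans
        (Nat.add_le_add_left Finset.card_image_le _)
      rw [← two_mul] at this
      exact_mod_cast this
    exact point_bound_le hη hθ hT0 hm hY hX
  have hsplit : numOf (ordNbhdsWith n r i₀ g) (fun ω =>
      (∃ i, i ≠ i₀ ∧ ∃ u, m ≤ (comp (funGraph (fun v => ω v i) B) u).card) ∨
      m ≤ (compUnion (funGraph (fun v => ω v i₁) B) (X ∪ X.image g)).card) ≤
      ∑ i : Option {i : Fin r // i ≠ i₀}, numOf (ordNbhdsWith n r i₀ g) (fun ω =>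
        match i with
        | none => m ≤ (compUnion (funGraph (fun v => ω v i₁) B)
            (X ∪ X.image g)).card
        | some i => ∃ u,
            m ≤ (comp (funGraph (fun v => ω v i.1) B) u).card) := by
    refine numOf_le_sum _ _ fun ω h => ?_
    rcases h with ⟨i, hi, hu⟩ | hu
    · exact ⟨some ⟨i, hi⟩, Finset.mem_univ _, hu⟩
    · exact ⟨none, Finset.mem_univ _, hu⟩
  rw [Fintype.sum_option] at hsplit
  refine hsplit.trans ?_
  have hr : (0 : ℝ) < r := by exact_mod_cast i₀.pos
  have h3 : ∑ i : {i : Fin r // i ≠ i₀}, numOf (ordNbhdsWith n r i₀ g) (fun ω => ∃ u,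
      m ≤ (comp (funGraph (fun v => ω v i.1) B) u).card) ≤
      r * (θ / (8 * r) * T) := by
    refine (Finset.sum_le_sum fun i _ => h1 i.1 i.2).trans ?_
    rw [Finset.sum_const, nsmul_eq_mul]
    refine mul_le_mul_of_nonneg_right ?_ (by positivity)
    rw [Nat.cast_le, Finset.card_univ]
    exact (Fintype.card_subtype_le _).trans (by rw [Fintype.card_fin])
  have h4 : (r : ℝ) * (θ / (8 * r) * T) = θ / 8 * T := by
    field_simp
  refine (add_le_add h2 (h3.trans h4.le)).trans ?_
  nlinarith [mul_nonneg hθ.le hT0]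

/-- The ordered digraphs for which the colouring by a balanced partition may fail: the components
left by the arcs of index `i₀` outside `X` are large, or those of the crossing arcs are. -/
def Exceptional {n r : ℕ} (i₀ i₁ : Fin r) (X : Finset (Fin n)) (m : ℕ)
    (π : (Fin n → Fin n) → Fin n → ℕ) (g : Fin n → Fin n) (ω : Fin n → Fin r → Fin n) : Prop :=
  (¬ ∃ u, m ≤ (comp (funGraph g fun v _ => v ∉ X) u).card) ∧
  ((∃ i, i ≠ i₀ ∧ ∃ u, m ≤ (comp (funGraph (fun v => ω v i) fun v w => π g v ≠ π g w) u).card) ∨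
    m ≤ (compUnion (funGraph (fun v => ω v i₁) fun v w => π g v ≠ π g w) (X ∪ X.image g)).card)

/-- Fixing `g` fixes the partition, while the other indices stay nearly uniform. Each part has at
least ηn vertices, so the crossing relation has rows and columns of at most (1 - η)n entries. -/
lemma numOf_exceptional_le {n r : ℕ} {i₀ i₁ : Fin r} (h01 : i₁ ≠ i₀) {X : Finset (Fin n)} {m : ℕ}
    {π : (Fin n → Fin n) → Fin n → ℕ}
    (hπ : ∀ g, (¬ ∃ u, m ≤ (comp (funGraph g fun v _ => v ∉ X) u).card) →
      ∀ v, m ≤ (Finset.univ.filter fun w => π g w = π g v).card)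
    {η θ : ℝ} (hη : 0 < η) (hθ : 0 < θ) (hn : 3 ≤ n) (hηn : 4 ≤ η * n) (hm : η * n ≤ m)
    (hX : 32 * (X.card : ℝ) ≤ θ * η ^ 3 * n) (hnr : 32 * r ≤ θ * η ^ 4 * n)
    (g : Fin n → Fin n) :
    numOf (ordNbhdsWith n r i₀ g) (Exceptional i₀ i₁ X m π g) ≤
      (θ / 2) * (Fintype.piFinset (ordNbhdsWith n r i₀ g)).card := by
  classical
  by_cases hg : ∃ u, m ≤ (comp (funGraph g fun v _ => v ∉ X) u).card
  · have : numOf (ordNbhdsWith n r i₀ g) (Exceptional i₀ i₁ X m π g) = 0 := by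
      rw [numOf, Nat.cast_eq_zero, Finset.card_eq_zero]
      exact Finset.filter_eq_empty_iff.2 fun ω _ h => h.1 hg
    rw [this]
    positivity
  have hcard : ∀ w, (Finset.univ.filter fun v => π g v ≠ π g w).card + m ≤ n := by
    intro w
    have h1 := Finset.card_filter_add_card_filter_not (s := (Finset.univ : Finset (Fin n)))
      fun v => π g v = π g w
    rw [Finset.card_univ, Fintype.card_fin] at h1
    have h2 := hπ g hg w
    have h3 : (Finset.univ.filter fun v => π g v ≠ π g w).card =
      (Finset.univ.filter fun v => ¬ π g v = π g w).card := rfl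
    omega
  have hcol : ∀ w, 1 / ((n : ℝ) - 2) *
      ((Finset.univ.filter fun v => π g v ≠ π g w).card : ℝ) ≤ 1 - η / 2 := fun w =>
    complement_ratio_le (hcard w) hm hηn hn
  have hrow : ∀ v, 1 / ((n : ℝ) - 2) *
      ((Finset.univ.filter fun w => π g v ≠ π g w).card : ℝ) ≤ 1 - η / 2 := fun v => by
    have : (Finset.univ.filter fun w => π g v ≠ π g w) =
        Finset.univ.filter fun w => π g w ≠ π g v :=
      Finset.filter_congr fun w _ => ne_comm
    rw [this]
    exact hcol v
  refine (numOf_mono fun ω h => h.2).trans ?_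
  exact numOf_large_crossing_comp_le h01 hη hθ hn hηn hm hX hnr g
    (fun w => by convert hcol w) (fun v => by convert hrow v)

/-- Only vertices outside `X` keep their arc, so the columns have at most (1 - δ)n entries; this
makes the pair count subcritical. -/
lemma numOf_large_core_comp_le {n r : ℕ} (i₀ : Fin r) {X : Finset (Fin n)} {m : ℕ}
    {η δ θ : ℝ} (hη : 0 < η) (hδ : 0 < δ) (hn : 3 ≤ n) (hm : η * n ≤ m)
    (hX : δ * n ≤ X.card) (hδn : 4 ≤ δ * n) (hnθ : 8 ≤ θ * δ ^ 2 * η ^ 2 * n) :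
    numOf (ordNbhds n r) (fun ω => ∃ u,
      m ≤ (comp (funGraph (fun v => ω v i₀) fun v _ => v ∉ X) u).card) ≤
      (θ / 2) * (Fintype.piFinset (ordNbhds n r)).card := by
  classical
  set T : ℝ := ((Fintype.piFinset (ordNbhds n r)).card : ℝ) with hT
  have hT0 : 0 ≤ T := Nat.cast_nonneg _
  have hn' : (3 : ℝ) ≤ n := by exact_mod_cast hn
  have hp0 : (0 : ℝ) ≤ 1 / ((n : ℝ) - 2) := by
    rw [one_div, inv_nonneg]
    linarith
  have hcol : 1 / ((n : ℝ) - 2) * ((Finset.univ.filter fun v => v ∉ X).card : ℝ) ≤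
      1 - δ / 2 := by
    refine complement_ratio_le ?_ hX hδn hn
    have h1 := Finset.card_filter_add_card_filter_not (s := (Finset.univ : Finset (Fin n)))
      fun v => v ∈ X
    rw [Finset.card_univ, Fintype.card_fin, Finset.filter_univ_mem] at h1
    omega
  have hρ : (0 : ℝ) ≤ 1 - δ / 2 := (mul_nonneg hp0 (Nat.cast_nonneg _)).trans hcol
  have h := numOf_large_comp_mul_le (Z := ordNbhds n r) (φ := fun y => y i₀)
    (B := fun v _ => v ∉ X) (fun v w => ordNbhds_fiber_le hn i₀ v w) hp0 hρ (by linarith)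
    (fun w => by convert hcol) m
  have hT4 := div_one_sub_one_sub_half_sq T δ
  have hm0 : (0 : ℝ) < m := lt_of_lt_of_le (by positivity) hm
  rw [← hT, hT4, Fintype.card_fin, ← le_div_iff₀ (by positivity)] at h
  refine h.trans ?_
  rw [div_le_iff₀ (by positivity)]
  exact core_bound_le hη hδ hT0 (by linarith) hm hnθ

/-! ### Small components at a fixed scale, and diagonalisation -/

lemma tendsto_small_components {r : ℕ} (hr : 2 ≤ r) {ε : ℝ} (hε : 0 < ε) (hε1 : ε ≤ 1) :
    Tendsto (fun n : ℕ => outLaw n r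
      {D | ∃ c : EdgeColouring (outGraph D) r, MonoComponentsLE c (ε * n)}) atTop (𝓝 1) := by
  classical
  refine tendsto_outLaw_one _ fun θ hθ => ?_
  -- The components will have at most 3m < 3(ηn + 1) = εn/2 + 3 vertices, which is at most εn once
  -- εn ≥ 6.
  set η : ℝ := ε / 6 with hη
  have hη0 : 0 < η := by positivity
  -- `X` must be so small that the expected total size of the components meeting it or its image is
  -- a small fraction of θm; the minimum with 1/2 lets `X` fit into the vertex set.
  set δ : ℝ := min (θ * η ^ 3 / 64) (1 / 2) with hδ
  have hδ0 : 0 < δ := by positivity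
  have hδθ : 64 * δ ≤ θ * η ^ 3 := by
    have : δ ≤ θ * η ^ 3 / 64 := min_le_left _ _
    linarith
  have hδ1 : δ ≤ 1 / 2 := min_le_right _ _
  let i₀ : Fin r := ⟨0, by omega⟩
  let i₁ : Fin r := ⟨1, by omega⟩
  have h01 : i₁ ≠ i₀ := by simp [i₀, i₁]
  have hlarge : ∀ c b : ℝ, 0 < c → ∀ᶠ n : ℕ in atTop, b ≤ c * n := fun c b hc =>
    (tendsto_natCast_atTop_atTop.const_mul_atTop hc).eventually_ge_atTop b
  filter_upwards [eventually_ge_atTop 3, hlarge η 4 hη0, hlarge δ 4 hδ0,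
    hlarge (θ * η ^ 4) (32 * r) (by positivity), hlarge (θ * δ ^ 2 * η ^ 2) 8 (by positivity),
    hlarge ε 6 hε] with n hn hηn hδn hnr hnθ hεn
  set m := ⌈η * n⌉₊ with hm
  have hm1 : η * n ≤ m := Nat.le_ceil _
  have hm2 : (m : ℝ) < η * n + 1 := Nat.ceil_lt_add_one (by positivity)
  have hx1 : δ * n ≤ ⌈δ * n⌉₊ := Nat.le_ceil _
  have hx2 : (⌈δ * n⌉₊ : ℝ) < δ * n + 1 := Nat.ceil_lt_add_one (by positivity)
  have hm0 : 0 < m := Nat.ceil_pos.2 (by linarith)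
  have hn' : (3 : ℝ) ≤ n := by exact_mod_cast hn
  have hmn : m ≤ n := by
    have : (m : ℝ) ≤ n := by
      have : ε * n ≤ n := mul_le_of_le_one_left (by positivity) hε1
      rw [hη] at hm2
      linarith
    exact_mod_cast this
  have hxn : ⌈δ * n⌉₊ ≤ (Finset.univ : Finset (Fin n)).card := by
    rw [Finset.card_univ, Fintype.card_fin]
    refine Nat.ceil_le.2 ?_
    nlinarith
  obtain ⟨X, -, hXc⟩ := Finset.exists_subset_card_eq hxn
  rw [← hXc] at hx1 hx2
  -- The partition is chosen as a function of the arcs of index i₀ alone, so that conditioning on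
  -- them leaves the other indices free.
  have hπ : ∀ g : Fin n → Fin n, ∃ π : Fin n → ℕ,
      (¬ ∃ u, m ≤ (comp (funGraph g fun v _ => v ∉ X) u).card) →
      (∀ v ∉ X, π (g v) = π v) ∧
      ∀ v, m ≤ (Finset.univ.filter fun w => π w = π v).card ∧
        (Finset.univ.filter fun w => π w = π v).card ≤ 3 * m := by
    intro g
    by_cases hg : ∃ u, m ≤ (comp (funGraph g fun v _ => v ∉ X) u).card
    · exact ⟨fun _ => 0, fun h => absurd hg h⟩
    · obtain ⟨π, hπ⟩ := exists_balanced_partition hm0 hmn X g hg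
      exact ⟨π, fun _ => hπ⟩
  choose π hπ using hπ
  let E₀ : (Fin n → Fin r → Fin n) → Prop := fun ω => ∃ u,
    m ≤ (comp (funGraph (fun v => ω v i₀) fun v _ => v ∉ X) u).card
  let E₁ : (Fin n → Fin r → Fin n) → Prop := fun ω =>
    Exceptional i₀ i₁ X m π (fun v => ω v i₀) ω
  have hE₀ : numOf (ordNbhds n r) E₀ ≤ θ / 2 * (Fintype.piFinset (ordNbhds n r)).card :=
    numOf_large_core_comp_le i₀ hη0 hδ0 hn hm1 hx1 hδn hnθ
  have hE₁ : numOf (ordNbhds n r) E₁ ≤ θ / 2 * (Fintype.piFinset (ordNbhds n r)).card := by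
    refine numOf_le_of_conditional i₀ (Exceptional i₀ i₁ X m π) fun g => ?_
    refine numOf_exceptional_le h01 (fun g hg v => ((hπ g hg).2 v).1) hη0 hθ hn hηn hm1 ?_ hnr g
    have h1 : 64 * δ * n ≤ θ * η ^ 3 * n := by gcongr
    linarith
  have hE : numOf (ordNbhds n r) (fun ω => E₀ ω ∨ E₁ ω) ≤
      θ * (Fintype.piFinset (ordNbhds n r)).card := by
    have h := numOf_le_sum (Z := ordNbhds n r) (E := fun ω => E₀ ω ∨ E₁ ω)
      (Finset.univ : Finset Bool) (fun b => if b then E₀ else E₁) (fun ω h => by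
        rcases h with h | h
        · exact ⟨true, Finset.mem_univ _, by simpa using h⟩
        · exact ⟨false, Finset.mem_univ _, by simpa using h⟩)
    rw [Fintype.sum_bool] at h
    simp only [if_true, Bool.false_eq_true, if_false] at h
    linarith
  refine ⟨(Finset.univ.filter fun D : OutDigraph n r =>
    ¬ ∃ c : EdgeColouring (outGraph D) r, MonoComponentsLE c (ε * n)).image
      fun D v => (D v).1, ?_, ?_⟩
  · intro D hD
    exact Finset.mem_image.2 ⟨D, Finset.mem_filter.2 ⟨Finset.mem_univ _, hD⟩, rfl⟩
  · refine card_le_of_numOf_le hE ?_ ?_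
    · intro S hS
      obtain ⟨D, -, rfl⟩ := Finset.mem_image.1 hS
      exact out_mem_outSets D
    · intro ω _ hωbad
      obtain ⟨D, hD, hDω⟩ := Finset.mem_image.1 hωbad
      by_contra hcon
      rw [not_or] at hcon
      obtain ⟨hπX, hπm⟩ := hπ _ hcon.1
      have hgood := fun h => hcon.2 ⟨hcon.1, h⟩
      rw [imp_false, not_or] at hgood
      obtain ⟨hg1, hg2⟩ := hgood
      refine (Finset.mem_filter.1 hD).2 ?_
      obtain ⟨c, hc⟩ := exists_colouring_of_partition D ω (fun v w => by
          have hDv : (D v).1 = unorder ω v := congrFun hDω v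
          rw [hDv, unorder]
          simp) h01 X (π fun v => ω v i₀) hπX (m := 3 * m) (fun v => (hπm v).2)
        (fun i hi u => by
          by_contra! h
          exact hg1 ⟨i, hi, u, by omega⟩)
        (by
          by_contra! h
          exact hg2 (by omega))
      refine ⟨c, fun i K => ?_⟩
      have h3 : (K.supp.ncard : ℝ) ≤ 3 * m := by exact_mod_cast hc i K
      rw [hη] at hm2
      linarith

/-- Diagonalisation: events that hold with high probability at every fixed scale `ε` hold with
high probability at some scale tending to zero. -/
lemma exists_isLittleO_of_tendsto {P : ℕ → ℝ → ENNReal} (hP1 : ∀ n x, P n x ≤ 1)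
    (hP : ∀ ε : ℝ, 0 < ε → ε ≤ 1 → Tendsto (fun n => P n (ε * n)) atTop (𝓝 1)) :
    ∃ f : ℕ → ℝ, f =o[atTop] (fun n : ℕ => (n : ℝ)) ∧
      Tendsto (fun n => P n (f n)) atTop (𝓝 1) := by
  classical
  let e : ℕ → ℝ := fun j => 1 / ((j : ℝ) + 1)
  have he0 : ∀ j, 0 < e j := fun j => Nat.one_div_pos_of_nat
  have he1 : ∀ j, e j ≤ 1 := fun j => by
    rw [div_le_one (by positivity)]
    linarith [(Nat.cast_nonneg j : (0 : ℝ) ≤ j)]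
  let a : ℕ → ENNReal := fun j => 1 - ((j : ENNReal) + 1)⁻¹
  have ha1 : ∀ j, a j < 1 := fun j =>
    ENNReal.sub_lt_self ENNReal.one_ne_top one_ne_zero (ENNReal.inv_ne_zero.2 (by finiteness))
  let Q : ℕ → ℕ → Prop := fun n j => a j ≤ P n (e j * n)
  have hQ : ∀ j, ∀ᶠ n in atTop, Q n j := fun j =>
    ((hP _ (he0 j) (he1 j)).eventually (lt_mem_nhds (ha1 j))).mono fun n h => h.le
  -- `M n` is the finest scale j ≤ n at which the probability already reaches 1 - 1/(j + 1). Every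
  -- fixed scale qualifies eventually, so `M` tends to infinity.
  let M : ℕ → ℕ := fun n => Nat.findGreatest (Q n) n
  have hM : Tendsto M atTop atTop := by
    rw [tendsto_atTop]
    intro j
    filter_upwards [hQ j, eventually_ge_atTop j] with n hn hj
    exact Nat.le_findGreatest hj hn
  have hQM : ∀ᶠ n in atTop, Q n (M n) := by
    filter_upwards [hQ 0] with n hn
    exact Nat.findGreatest_spec (P := Q n) (Nat.zero_le n) hn
  refine ⟨fun n => e (M n) * n, ?_, ?_⟩
  · have h0 : Tendsto (fun n => e (M n)) atTop (𝓝 0) :=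
      tendsto_one_div_add_atTop_nhds_zero_nat.comp hM
    have := (isLittleO_one_iff ℝ).2 h0
    simpa using this.mul_isBigO (isBigO_refl (fun n : ℕ => (n : ℝ)) atTop)
  · have hinv : Tendsto (fun j : ℕ => ((j : ENNReal) + 1)⁻¹) atTop (𝓝 0) := by
      have := ENNReal.tendsto_inv_nat_nhds_zero.comp (tendsto_add_atTop_nat 1)
      refine this.congr fun j => ?_
      simp
    have ha : Tendsto a atTop (𝓝 1) := by
      have := ENNReal.Tendsto.sub (tendsto_const_nhds (x := (1 : ENNReal))) hinv
        (Or.inl ENNReal.one_ne_top)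
      rwa [tsub_zero] at this
    exact tendsto_of_tendsto_of_tendsto_of_le_of_le' (ha.comp hM) tendsto_const_nhds hQM
      (Eventually.of_forall fun n => hP1 n _)

lemma outLaw_le_one (n k : ℕ) (E : Set (OutDigraph n k)) : outLaw n k E ≤ 1 := by
  rw [outLaw_eq_uniformOn]
  exact prob_le_one

end KOut

theorem theorem2 (r : ℕ) (hr : 2 ≤ r) :
    (∃ f : ℕ → ℝ, f =o[atTop] (fun n : ℕ => (n : ℝ)) ∧
      Tendsto (fun n : ℕ => KOut.outLaw n r
        {D | ∃ c : KOut.EdgeColouring (KOut.outGraph D) r, KOut.MonoComponentsLE c (f n)})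
        atTop (𝓝 1)) ∧
    (∃ γ : ℝ, 0 < γ ∧
      Tendsto (fun n : ℕ => KOut.outLaw n (r + 1)
        {D | ∀ c : KOut.EdgeColouring (KOut.outGraph D) r, KOut.HasMonoCycleGE c (γ * n)})
        atTop (𝓝 1)) :=
  ⟨KOut.exists_isLittleO_of_tendsto
    (P := fun n x => KOut.outLaw n r
      {D | ∃ c : KOut.EdgeColouring (KOut.outGraph D) r, KOut.MonoComponentsLE c x})
    (fun n _ => KOut.outLaw_le_one n r _)
    (fun _ hε hε1 => KOut.tendsto_small_components hr hε hε1),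
   KOut.exists_tendsto_long_cycle (by omega)⟩
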